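/- Let $M=\{1,\dots,m\}$ be a set of $m\ge 2$ items. A valuation $v:2^M\to\mathbb R_{\ge 0}$ is a \emph{weighted matroid-rank valuation} if there are a matroid $(M,\mathcal I)$ and weights $\omega:M\to\mathbb R_{\ge 0}$ with $v(S)=\max\{\sum_{a\in A}\omega(a): A\subseteq S,\ A\in\mathcal I\}$ for all $S\subseteq M$. A \emph{bundle-size pricing menu} $\mathcal M$ consists of a set $Q\subseteq\{0,\dots,m\}$ of offered sizes with $0\in Q$, and prices $p_q$ ($q\in Q$) with $p_0=0$ that are strictly increasing in $q$; the buyer may get any bundle $S$ with $|S|\in Q$ for the price $p_{|S|}$. A bundle is \emph{profit-maximizing} for $v$ if it maximizes $v(S)-p_{|S|}$ over all $S\subseteq M$ with $|S|\in Q$. A buyer with valuation $v$ picks a profit-maximizing bundle, breaking ties in an arbitrary, possibly randomized way (measurable in $v$), and $\mathrm{Rev}(\mathcal M,\mathcal D)$ is the expected price she pays when $v\sim\mathcal D$. A value query on $S$ returns $v(S)$. A demand query at item prices $p\in\mathbb R_{\ge 0}^M$ returns an arbitrary set $S$ that maximizes $v(S)-\sum_{i\in S}p_i$ over all subsets of $M$,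 together with $v(S)$; ties may be broken adversarially. **Theorem.** There is a universal constant $C>0$ such that the following holds for every $m\ge 2$, every probability distribution $\mathcal D$ over weighted matroid-rank valuations on $M$ (arbitrary correlation between the items is allowed), every bundle-size pricing menu $\mathcal M_1$ and every $\varepsilon>0$. There is a bundle-size pricing menu $\mathcal M_2$ such that $$\mathrm{Rev}(\mathcal M_2,\mathcal D)\ \ge\ (1-\varepsilon)\,\mathrm{Rev}(\mathcal M_1,\mathcal D),$$ whatever the tie-breaking rules of the buyer in the two menus are, and there is a randomized adaptive algorithm, using value and demand queries only, that for every weighted matroid-rank valuation $v$ on $M$ always (for all outcomes of its random coins and every tie-breaking in the demand queries) returns a profit-maximizing bundle of $\mathcal M_2$ for $v$, and whose number of queries, in expectation over its internal random coins and over $v\sim\mathcal D$, with ties in the demand queries broken in the worst way, is at most $C\,\varepsilon^{-3}\log^4 m$. -/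

import Mathlib

open MeasureTheory
open scoped NNReal ENNReal

namespace BundlePricing

/-- Set functions on the items `Fin m`; such a function assigns a real value to each bundle. -/
abbrev SetFun (m : ℕ) : Type := Finset (Fin m) → ℝ

/-- `v` is a weighted matroid-rank valuation: for some matroid on the whole item set and some
nonnegative weights, `v S` is the largest weight of an independent subset of `S`.
Such a `v` is automatically normalized, monotone and nonnegative. -/
def IsWeightedMatroidRank {m : ℕ} (v : SetFun m) : Prop :=
  ∃ (N : Matroid (Fin m)) (w : Fin m → ℝ≥0), N.E = Set.univ ∧
    ∀ S : Finset (Fin m),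
      IsGreatest {x : ℝ | ∃ A : Finset (Fin m), A ⊆ S ∧ N.Indep (A : Set (Fin m)) ∧
        x = ∑ a ∈ A, (w a : ℝ)} (v S)

/-- A bundle-size pricing menu: the offers are "pay `price q` and choose any bundle of size `q`",
for the sizes `q` in `sizes`. Getting nothing for free is always offered, and among the offered
sizes larger ones are strictly more expensive. Values of `price` outside `sizes` play no role. -/
structure BundleSizeMenu (m : ℕ) where
  sizes : Finset ℕ
  price : ℕ → ℝ
  sizes_le : ∀ q ∈ sizes, q ≤ m
  zero_mem : 0 ∈ sizes
  price_zero : price 0 = 0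
  strictMono : StrictMonoOn price (sizes : Set ℕ)

/-- `S` is a profit-maximizing bundle of the menu for a buyer with valuation `v`. -/
def BundleSizeMenu.IsMostProfitable {m : ℕ} (M : BundleSizeMenu m) (v : SetFun m)
    (S : Finset (Fin m)) : Prop :=
  S.card ∈ M.sizes ∧
    ∀ T : Finset (Fin m), T.card ∈ M.sizes →
      v T - M.price T.card ≤ v S - M.price S.card

/-- A (possibly randomized) way in which the buyer picks among her profit-maximizing bundles:
`prob v S` is the probability that a buyer with valuation `v` picks the bundle `S`. -/
structure BuyerRule {m : ℕ} (M : BundleSizeMenu m) where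
  prob : SetFun m → Finset (Fin m) → ℝ
  nonneg : ∀ v S, 0 ≤ prob v S
  sum_eq_one : ∀ v, ∑ S : Finset (Fin m), prob v S = 1
  isMostProfitable : ∀ v S, prob v S ≠ 0 → M.IsMostProfitable v S
  measurable : ∀ S, Measurable fun v => prob v S

/-- The expected payment of a buyer with valuation `v`. -/
noncomputable def BuyerRule.revenueAt {m : ℕ} {M : BundleSizeMenu m} (β : BuyerRule M)
    (v : SetFun m) : ℝ :=
  ∑ S : Finset (Fin m), M.price S.card * β.prob v S

/-- The expected revenue when the valuation is drawn from `D`. The integrand is measurable and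
bounded. -/
noncomputable def BuyerRule.revenue {m : ℕ} {M : BundleSizeMenu m} (β : BuyerRule M)
    (D : Measure (SetFun m)) : ℝ :=
  ∫ v, β.revenueAt v ∂D

/-- `S` is a possible answer to the demand query with item prices `p`. -/
def IsDemanded {m : ℕ} (v : SetFun m) (p : Fin m → ℝ≥0) (S : Finset (Fin m)) : Prop :=
  ∀ T : Finset (Fin m), v T - ∑ i ∈ T, (p i : ℝ) ≤ v S - ∑ i ∈ S, (p i : ℝ)

/-- Randomized adaptive algorithms with access to a valuation by value and demand queries.
* `output S` stops and returns the bundle `S`;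
* `value S next` asks for the value of `S` and continues according to the answer;
* `demand p next` makes a demand query at item prices `p`, and continues according to the
  demanded bundle that is returned and its value;
* `rand n next` draws one of `n + 1` outcomes uniformly at random and continues accordingly. -/
inductive QueryAlg (m : ℕ) : Type
  | output (S : Finset (Fin m)) : QueryAlg m
  | value (S : Finset (Fin m)) (next : ℝ → QueryAlg m) : QueryAlg m
  | demand (p : Fin m → ℝ≥0) (next : Finset (Fin m) → ℝ → QueryAlg m) : QueryAlg m
  | rand (n : ℕ) (next : Fin (n + 1) → QueryAlg m) : QueryAlg m

/-- On the valuation `v` the algorithm returns a bundle satisfying `P`, whatever its random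
choices are and however the ties in the demand queries are broken. -/
def QueryAlg.AlwaysReturns {m : ℕ} (v : SetFun m) (P : Finset (Fin m) → Prop) :
    QueryAlg m → Prop
  | .output S => P S
  | .value S next => (next (v S)).AlwaysReturns v P
  | .demand p next => ∀ S, IsDemanded v p S → (next S (v S)).AlwaysReturns v P
  | .rand n next => ∀ i : Fin (n + 1), (next i).AlwaysReturns v P

/-- The number of value and demand queries made on the valuation `v`, in expectation over the
random choices of the algorithm, when ties in the demand queries are broken in the worst
possible way (possibly depending on the run so far). -/
noncomputable def QueryAlg.expectedQueries {m : ℕ} (v : SetFun m) : QueryAlg m → ℝ≥0∞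
  | .output _ => 0
  | .value S next => 1 + (next (v S)).expectedQueries v
  | .demand p next =>
      1 + ⨆ (S : Finset (Fin m)) (_ : IsDemanded v p S), (next S (v S)).expectedQueries v
  | .rand n next => (∑ i : Fin (n + 1), (next i).expectedQueries v) / ((n + 1 : ℕ) : ℝ≥0∞)

/-- The (upper) expectation of a nonnegative quantity: the infimum of the expectations of the
measurable functions above it. It is the usual expectation if `f` is measurable, and it bounds
the expectation from above in any case. -/
noncomputable def upperExpectation {Ω : Type} [MeasurableSpace Ω] (D : Measure Ω)
    (f : Ω → ℝ≥0∞) : ℝ≥0∞ :=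
  ⨅ (g : Ω → ℝ≥0∞) (_ : Measurable g) (_ : ∀ᵐ x ∂D, f x ≤ g x), ∫⁻ x, g x ∂D

end BundlePricing

/-! The menu `M₂` is `M₁` with its positive prices rounded down to powers of `1 + (ε/2)^2` and then
discounted by the factor `1 - ε/2`. In absolute terms the discount is larger on expensive bundles,
so a buyer has no reason to move to a much cheaper one; this is the revenue bound
`le_price_rounded`. In return, only `O(ε⁻² log m)` prices lie in any range `[L/m, 2L]`.

For a weighted matroid rank, best bundles of all sizes can be read off from one greedy base, and a
demand query at a small uniform price `η` returns such a base (`isGreedyBase_of_isDemanded`).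
Quickselect inside it, comparing by demand queries just above and just below the pivot's value,
finds a best bundle of a given size in `O(log m)` expected queries
(`select_expectedQueries_le_of_isGreedyBase`). Binary search for the place where the price overtakes
the loss `v univ - v A` of the best bundles `A` yields a scale `L`, and it suffices to evaluate the
sizes priced in `[L/m, 2L]` and one more (`le_of_window`). The cheap sizes are handled by concavity
of the best value as a function of the size, in the form of supporting item prices.

All this needs `η` below the positive item values and their positive differences. No `η` serves all
valuations, but one depending on `D` fails with probability at most `1/W`, where `W` bounds the cost
on every valuation. So failures add at most one query in expectation. They never harm correctness,
since each candidate bundle is certified by a demand query, with brute force as the fallback. -/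

namespace BundlePricing

/-! ### Weighted matroid rank and greedy bases -/

section MatroidRank

variable {m : ℕ} {v : SetFun m} {N : Matroid (Fin m)} {w : Fin m → ℝ≥0}

/-- `v S` is the largest weight of an independent subset of `S`. -/
def IsRankOf (v : SetFun m) (N : Matroid (Fin m)) (w : Fin m → ℝ≥0) : Prop :=
  ∀ S : Finset (Fin m),
    IsGreatest {x : ℝ | ∃ A : Finset (Fin m), A ⊆ S ∧ N.Indep (A : Set (Fin m)) ∧
      x = ∑ a ∈ A, (w a : ℝ)} (v S)

lemma IsRankOf.exists_indep (hv : IsRankOf v N w) (S : Finset (Fin m)) :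
    ∃ A ⊆ S, N.Indep (A : Set (Fin m)) ∧ v S = ∑ a ∈ A, (w a : ℝ) := by
  obtain ⟨A, h1, h2, h3⟩ := (hv S).1
  exact ⟨A, h1, h2, h3⟩

lemma IsRankOf.sum_le (hv : IsRankOf v N w) {A S : Finset (Fin m)} (hAS : A ⊆ S)
    (hA : N.Indep (A : Set (Fin m))) : ∑ a ∈ A, (w a : ℝ) ≤ v S :=
  (hv S).2 ⟨A, hAS, hA, rfl⟩

lemma IsRankOf.eq_sum (hv : IsRankOf v N w) {A : Finset (Fin m)}
    (hA : N.Indep (A : Set (Fin m))) : v A = ∑ a ∈ A, (w a : ℝ) := by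
  refine le_antisymm ?_ (hv.sum_le subset_rfl hA)
  obtain ⟨B, hB, -, h⟩ := hv.exists_indep A
  rw [h]
  exact Finset.sum_le_sum_of_subset_of_nonneg hB fun _ _ _ => NNReal.coe_nonneg _

lemma IsRankOf.mono (hv : IsRankOf v N w) {S T : Finset (Fin m)} (h : S ⊆ T) : v S ≤ v T := by
  obtain ⟨A, hA, hi, e⟩ := hv.exists_indep S
  rw [e]
  exact hv.sum_le (hA.trans h) hi

lemma IsRankOf.singleton (hv : IsRankOf v N w) {A : Finset (Fin m)}
    (hA : N.Indep (A : Set (Fin m))) {a : Fin m} (ha : a ∈ A) : v {a} = w a := by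
  rw [hv.eq_sum (hA.subset (by simpa using ha)), Finset.sum_singleton]

lemma IsWeightedMatroidRank.mono (hv : IsWeightedMatroidRank v) {S T : Finset (Fin m)}
    (h : S ⊆ T) : v S ≤ v T := by
  obtain ⟨N, w, -, hr⟩ := hv
  exact IsRankOf.mono (N := N) (w := w) hr h

lemma IsWeightedMatroidRank.empty (hv : IsWeightedMatroidRank v) : v ∅ = 0 := by
  obtain ⟨N, w, -, hr⟩ := hv
  simpa using IsRankOf.eq_sum (N := N) (w := w) (A := ∅) hr (by simp)

lemma IsWeightedMatroidRank.nonneg (hv : IsWeightedMatroidRank v) (S : Finset (Fin m)) :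
    0 ≤ v S := hv.empty ▸ hv.mono (Finset.empty_subset S)

lemma IsRankOf.indep_of_isDemanded (hv : IsRankOf v N w) {η : ℝ≥0} (hη : 0 < η)
    {X : Finset (Fin m)} (hX : IsDemanded v (fun _ => η) X) : N.Indep (X : Set (Fin m)) := by
  obtain ⟨A, hA, hi, e⟩ := hv.exists_indep X
  have h := hX A
  rw [e, hv.eq_sum hi] at h
  simp only [Finset.sum_const, nsmul_eq_mul] at h
  have hc : (X.card : ℝ) ≤ A.card := by
    have : (0 : ℝ) < η := hη
    nlinarith
  rwa [← Finset.eq_of_subset_of_card_le hA (by exact_mod_cast hc)]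

/-- A set demanded at a uniform price has, above every level, at least as many elements as any
independent set of elements worth more than the price. -/
lemma IsRankOf.card_le_card_filter (hv : IsRankOf v N w) {η : ℝ≥0} (hη : 0 < η)
    {X B : Finset (Fin m)} (hX : IsDemanded v (fun _ => η) X) (hB : N.Indep (B : Set (Fin m)))
    {t : ℝ≥0} (hηt : η < t) (hBt : ∀ b ∈ B, t ≤ w b) :
    B.card ≤ (X.filter fun x => t ≤ w x).card := by
  by_contra! hlt
  have hXi := hv.indep_of_isDemanded hη hX
  set Y := X.filter fun x => t ≤ w x with hY
  have hYi : N.Indep (Y : Set (Fin m)) := hXi.subset (by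
    exact_mod_cast Finset.filter_subset _ _)
  obtain ⟨b, ⟨hbB, hbY⟩, hbi⟩ := hYi.augment hB (by
    simpa [Set.encard_coe_eq_coe_finsetCard] using hlt)
  have hbB' : b ∈ B := by simpa using hbB
  have hbX : b ∉ X := fun h => hbY (by
    simpa [hY] using ⟨h, hBt b hbB'⟩)
  have hsub : (insert b (Y : Set (Fin m))) ⊆ ((insert b X : Finset (Fin m)) : Set (Fin m)) := by
    rw [Finset.coe_insert]
    exact Set.insert_subset_insert (by exact_mod_cast Finset.filter_subset _ _)
  -- A basis of `insert b X` containing `insert b Y` omits at most one element, and that one weighs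
  -- less than `t`. So it is more profitable than `X`: either `b` is added at a profit, or it
  -- replaces a lighter element.
  obtain ⟨J', hJ', hYJ'⟩ := hbi.subset_isBasis'_of_subset hsub
  obtain ⟨J, rfl⟩ : ∃ J : Finset (Fin m), (J : Set (Fin m)) = J' :=
    ⟨J'.toFinite.toFinset, by simp⟩
  have hJsub : J ⊆ insert b X := by exact_mod_cast hJ'.subset
  have hYJ : insert b Y ⊆ J := by
    rw [← Finset.coe_subset, Finset.coe_insert]; exact hYJ'
  have hcard : X.card ≤ J.card := by
    have h1 : N.Indep (X : Set (Fin m)) := hXi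
    by_contra! hl
    obtain ⟨x, ⟨hx1, hx2⟩, hxi⟩ := hJ'.indep.augment h1 (by
      simpa [Set.encard_coe_eq_coe_finsetCard] using hl)
    refine hx2 (hJ'.mem_of_insert_indep ?_ hxi)
    simp only [Finset.coe_insert]
    exact Set.mem_insert_of_mem _ hx1
  have hdem := hX J
  rw [hv.eq_sum hJ'.indep, hv.eq_sum hXi, ← Finset.sum_sub_distrib, ← Finset.sum_sub_distrib]
    at hdem
  have hwb : (t : ℝ) ≤ w b := hBt b hbB'
  have hηt' : (η : ℝ) < t := hηt
  by_cases hJ : insert b X ⊆ J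
  · rw [Finset.Subset.antisymm hJsub hJ, Finset.sum_insert hbX] at hdem
    linarith
  · obtain ⟨x, hx, hxJ⟩ := Finset.not_subset.1 hJ
    have hbJ : b ∈ J := hYJ (Finset.mem_insert_self _ _)
    have hxb : x ≠ b := fun h => hxJ (h ▸ hbJ)
    have hxX : x ∈ X := (Finset.mem_insert.1 hx).resolve_left hxb
    have hwx : (w x : ℝ) < t := by
      by_contra! h
      exact hxJ (hYJ (Finset.mem_insert_of_mem (by
        rw [hY, Finset.mem_filter]; exact ⟨hxX, h⟩)))
    have hJe : J = (insert b X).erase x := by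
      refine Finset.eq_of_subset_of_card_le ?_ ?_
      · exact fun y hy => Finset.mem_erase.2 ⟨fun h => hxJ (h ▸ hy), hJsub hy⟩
      · rw [Finset.card_erase_of_mem hx, Finset.card_insert_of_notMem hbX]; simpa using hcard
    have h1 := Finset.add_sum_erase (insert b X) (fun i => (w i : ℝ) - η) hx
    rw [← hJe, Finset.sum_insert hbX] at h1
    linarith

/-- The level counts of `card_le_card_filter` are Hall's condition for an injection of `B` into `X`
that never decreases the weight. -/
lemma IsRankOf.sum_sub_le (hv : IsRankOf v N w) {η : ℝ≥0} (hη : 0 < η)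
    {X B : Finset (Fin m)} (hX : IsDemanded v (fun _ => η) X) (hB : N.Indep (B : Set (Fin m)))
    (hBη : ∀ b ∈ B, η < w b) (p : ℝ) :
    ∑ b ∈ B, ((w b : ℝ) - p) ≤ ∑ x ∈ X, max ((w x : ℝ) - p) 0 := by
  have hall : ∀ s : Finset B, s.card ≤
      (s.biUnion fun b => X.filter fun x => w b.1 ≤ w x).card := by
    intro s
    rcases s.eq_empty_or_nonempty with rfl | hs
    · simp
    obtain ⟨b₀, hb₀, hmin⟩ := s.exists_min_image (fun b => w b.1) hs
    have h1 := hv.card_le_card_filter hη hX (B := s.map (Function.Embedding.subtype _))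
      (hB.subset (by
        intro x hx
        simp only [Finset.coe_map, Set.mem_image] at hx
        obtain ⟨y, -, rfl⟩ := hx
        exact y.2)) (hBη b₀ b₀.2) (by
        intro b hb
        obtain ⟨y, hy, rfl⟩ := Finset.mem_map.1 hb
        exact hmin y hy)
    rw [Finset.card_map] at h1
    refine h1.trans (Finset.card_le_card ?_)
    exact Finset.subset_biUnion_of_mem (fun b : B => X.filter fun x => w b.1 ≤ w x) hb₀
  obtain ⟨φ, hφ, hφX⟩ := (Finset.all_card_le_biUnion_card_iff_exists_injective _).1 hall
  simp only [Finset.mem_filter] at hφX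
  calc ∑ b ∈ B, ((w b : ℝ) - p) = ∑ b : B, ((w b.1 : ℝ) - p) := by
        rw [← Finset.sum_coe_sort]
    _ ≤ ∑ b : B, max ((w (φ b) : ℝ) - p) 0 := by
        refine Finset.sum_le_sum fun b _ => le_max_of_le_left ?_
        have : (w b.1 : ℝ) ≤ w (φ b) := (hφX b).2
        linarith
    _ = ∑ x ∈ Finset.univ.image φ, max ((w x : ℝ) - p) 0 := by
        rw [Finset.sum_image fun _ _ _ _ h => hφ h]
    _ ≤ _ := by
        refine Finset.sum_le_sum_of_subset_of_nonneg ?_ fun _ _ _ => le_max_right _ _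
        intro x hx
        obtain ⟨b, -, rfl⟩ := Finset.mem_image.1 hx
        exact (hφX b).1

/-- On `X`, the valuation `v` is additive with positive weights, and every set formed by the
items of `X` above some threshold is a best set of its size. -/
structure IsGreedyBase (v : SetFun m) (X : Finset (Fin m)) : Prop where
  additive : ∀ A ⊆ X, v A = ∑ a ∈ A, v {a}
  pos : ∀ x ∈ X, 0 < v {x}
  upper_optimal : ∀ A ⊆ X, ∀ p : ℝ, 0 ≤ p → (∀ a ∈ A, p ≤ v {a}) → (∀ z ∈ X, z ∉ A → v {z} ≤ p) →
    ∀ S : Finset (Fin m), v S - p * S.card ≤ v A - p * A.card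

/-- The gap ensures that the price `η` discourages no item of positive value, so `X` dominates every
independent set of such items. -/
lemma isGreedyBase_of_isDemanded (hv : IsWeightedMatroidRank v) {η : ℝ≥0} (hη : 0 < η)
    (hgap : ∀ i, 0 < v {i} → (η : ℝ) < v {i}) {X : Finset (Fin m)}
    (hX : IsDemanded v (fun _ => η) X) : IsGreedyBase v X := by
  obtain ⟨N, w, -, hr⟩ := hv
  change IsRankOf v N w at hr
  have hXi := hr.indep_of_isDemanded hη hX
  have hsing : ∀ x ∈ X, v {x} = w x := fun x hx => hr.singleton hXi hx
  have hadd : ∀ A ⊆ X, v A = ∑ a ∈ A, v {a} := by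
    intro A hA
    rw [hr.eq_sum (hXi.subset (by exact_mod_cast hA))]
    exact Finset.sum_congr rfl fun a ha => (hsing a (hA ha)).symm
  refine ⟨hadd, fun x hx => ?_, fun A hA p hp hpA hpX S => ?_⟩
  · have h := hX (X.erase x)
    have h1 := Finset.add_sum_erase X (fun a => v {a}) hx
    have h2 := Finset.add_sum_erase X (fun _ => (η : ℝ)) hx
    rw [hadd _ (Finset.erase_subset _ _), hadd X subset_rfl] at h
    have : (0 : ℝ) < η := hη
    linarith
  · obtain ⟨B, hB, hBi, e⟩ := hr.exists_indep S
    -- Items of weight zero do not exceed `η`; dropping them keeps the value and does not increase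
    -- the size.
    set B' := B.filter fun b => 0 < w b with hB'
    have hsum : ∑ b ∈ B, (w b : ℝ) = ∑ b ∈ B', (w b : ℝ) := by
      rw [hB', Finset.sum_filter]
      refine Finset.sum_congr rfl fun b _ => ?_
      split_ifs with h
      · rfl
      · simpa using h
    have hB'i : N.Indep (B' : Set (Fin m)) := hBi.subset (by
      exact_mod_cast Finset.filter_subset _ _)
    have key := hr.sum_sub_le hη hX hB'i (fun b hb => by
      have h1 := hr.singleton hB'i hb
      have h2 := hgap b (by rw [h1]; exact_mod_cast (Finset.mem_filter.1 hb).2)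
      rw [h1] at h2
      exact_mod_cast h2) p
    have hle : (B'.card : ℝ) ≤ S.card := by
      exact_mod_cast Finset.card_le_card ((Finset.filter_subset _ _).trans hB)
    have hXA : ∑ x ∈ X, max ((w x : ℝ) - p) 0 = ∑ a ∈ A, ((w a : ℝ) - p) := by
      rw [← Finset.sum_subset hA]
      · refine Finset.sum_congr rfl fun a ha => max_eq_left ?_
        have := hpA a ha
        rw [hsing a (hA ha)] at this
        linarith
      · intro x hx hxA
        have := hpX x hx hxA
        rw [hsing x hx] at this
        exact max_eq_right (by linarith)
    rw [hXA, Finset.sum_sub_distrib, Finset.sum_sub_distrib] at key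
    simp only [Finset.sum_const, nsmul_eq_mul] at key
    rw [e, hsum, hr.eq_sum (hXi.subset (by exact_mod_cast hA))]
    nlinarith

end MatroidRank


/-! ### Query counts of single steps -/

section Cost

variable {m : ℕ} {v : SetFun m}

lemma QueryAlg.expectedQueries_value_le {S : Finset (Fin m)} {next : ℝ → QueryAlg m} {b : ℝ≥0∞}
    (h : (next (v S)).expectedQueries v ≤ b) : (QueryAlg.value S next).expectedQueries v ≤ 1 + b := by
  simp only [QueryAlg.expectedQueries]
  gcongr

lemma QueryAlg.expectedQueries_demand_le {p : Fin m → ℝ≥0} {next : Finset (Fin m) → ℝ → QueryAlg m}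
    {b : ℝ≥0∞} (h : ∀ S, IsDemanded v p S → (next S (v S)).expectedQueries v ≤ b) :
    (QueryAlg.demand p next).expectedQueries v ≤ 1 + b := by
  simp only [QueryAlg.expectedQueries]
  gcongr
  exact iSup₂_le h

lemma QueryAlg.expectedQueries_rand_le {n : ℕ} {next : Fin (n + 1) → QueryAlg m}
    {b : ℝ≥0∞} (f : Fin (n + 1) → ℝ≥0∞) (h : ∀ i, (next i).expectedQueries v ≤ f i)
    (hf : ∑ i, f i ≤ b * (n + 1 : ℕ)) : (QueryAlg.rand n next).expectedQueries v ≤ b := by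
  simp only [QueryAlg.expectedQueries]
  exact ENNReal.div_le_of_le_mul ((Finset.sum_le_sum fun i _ => h i).trans hf)

lemma QueryAlg.expectedQueries_rand_le_const {n : ℕ} {next : Fin (n + 1) → QueryAlg m}
    {b : ℝ≥0∞} (h : ∀ i, (next i).expectedQueries v ≤ b) :
    (QueryAlg.rand n next).expectedQueries v ≤ b :=
  expectedQueries_rand_le (fun _ => b) h (by simp [mul_comm])

end Cost

/-! ### Brute force over all bundles -/

section BruteForce

variable {m : ℕ} {v : SetFun m}

/-- Query the values of all sets in a list, updating the table `u`. -/
noncomputable def queryAll (next : SetFun m → QueryAlg m) :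
    List (Finset (Fin m)) → SetFun m → QueryAlg m
  | [], u => next u
  | S :: l, u => .value S fun x => queryAll next l (Function.update u S x)

lemma queryAll_alwaysReturns {next : SetFun m → QueryAlg m} {P : Finset (Fin m) → Prop}
    (h : (next v).AlwaysReturns v P) (l : List (Finset (Fin m))) (u : SetFun m)
    (hu : ∀ S, S ∉ l → u S = v S) : (queryAll next l u).AlwaysReturns v P := by
  induction l generalizing u with
  | nil =>
    rw [show u = v from funext fun S => hu S (by simp)]
    exact h
  | cons S l ih =>
    refine ih _ fun T hT => ?_
    by_cases hTS : T = S
    · subst hTS; simp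
    · rw [Function.update_of_ne hTS]
      exact hu T (by simp [hTS, hT])

lemma queryAll_expectedQueries_le {next : SetFun m → QueryAlg m}
    (h : ∀ u, (next u).expectedQueries v = 0) (l : List (Finset (Fin m))) (u : SetFun m) :
    (queryAll next l u).expectedQueries v ≤ l.length := by
  induction l generalizing u with
  | nil => simp [queryAll, h]
  | cons S l ih =>
    refine (QueryAlg.expectedQueries_value_le (ih _)).trans ?_
    simp [add_comm]

lemma BundleSizeMenu.exists_isMostProfitable (M : BundleSizeMenu m) (v : SetFun m) :
    ∃ S, M.IsMostProfitable v S := by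
  obtain ⟨S, hS, h⟩ := (Finset.univ.filter fun S : Finset (Fin m) => S.card ∈ M.sizes).exists_max_image
    (fun S => v S - M.price S.card) ⟨∅, by simp [M.zero_mem]⟩
  exact ⟨S, (Finset.mem_filter.1 hS).2, fun T hT => h T (by simp [hT])⟩

/-- Query the values of all bundles and return a most profitable one. -/
noncomputable def bruteForce (M : BundleSizeMenu m) : QueryAlg m :=
  queryAll (fun u => .output (M.exists_isMostProfitable u).choose) Finset.univ.toList 0

lemma bruteForce_alwaysReturns (M : BundleSizeMenu m) (v : SetFun m) :
    (bruteForce M).AlwaysReturns v (M.IsMostProfitable v) := by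
  refine queryAll_alwaysReturns ?_ _ _ (by simp)
  exact (M.exists_isMostProfitable v).choose_spec

lemma bruteForce_expectedQueries_le (M : BundleSizeMenu m) (v : SetFun m) :
    (bruteForce M).expectedQueries v ≤ (2 ^ m : ℕ) := by
  refine (queryAll_expectedQueries_le (fun _ => rfl) _ _).trans ?_
  simp

end BruteForce

/-! ### Averaging over random pivots -/

section Partition

variable {ι : Type*} [DecidableEq ι]

lemma sq_card_le_two_mul_sum_card_filter (s : Finset ι) (u : ι → ℝ) :
    s.card ^ 2 ≤ 2 * ∑ e ∈ s, (s.filter fun y => u e ≤ u y).card := by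
  have h1 : ∑ e ∈ s, (s.filter fun y => u e ≤ u y).card =
      ∑ e ∈ s, (s.filter fun y => u y ≤ u e).card :=
    Finset.sum_card_bipartiteAbove_eq_sum_card_bipartiteBelow (fun e y => u e ≤ u y)
  have h2 : ∀ e ∈ s, s.card ≤ (s.filter fun y => u e ≤ u y).card +
      (s.filter fun y => u y ≤ u e).card := by
    intro e _
    refine le_trans (Finset.card_le_card ?_) (Finset.card_union_le _ _)
    intro y hy
    rcases le_total (u e) (u y) with h | h <;> simp [hy, h]
  have h3 := Finset.sum_le_sum h2
  rw [Finset.sum_add_distrib, ← h1, Finset.sum_const, smul_eq_mul] at h3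
  nlinarith

/-- The number of candidates that are left when the `k` largest elements of `Y` are searched and
`e` is the pivot. -/
noncomputable def pivotRest (u : ι → ℝ) (Y : Finset ι) (k : ℕ) (e : ι) : ℕ :=
  if k ≤ (Y.filter fun y => u e < u y).card then (Y.filter fun y => u e < u y).card
  else if (Y.filter fun y => u e ≤ u y).card < k then (Y \ Y.filter fun y => u e ≤ u y).card
  else 0

/-- Let `A` and `B` be the pivots that are too small and too large. A pivot in `A` discards the
elements of `A` not above it, on average at least `|A|/2` of them, and likewise for `B`. Hence the
sum is at most `(|A| + |B|)|Y| - (|A|² + |B|²)/2`, where `|A| + |B| ≤ |Y|`. -/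
lemma sum_pivotRest_le (u : ι → ℝ) (Y : Finset ι) (k : ℕ) :
    4 * ∑ e ∈ Y, pivotRest u Y k e ≤ 3 * Y.card ^ 2 := by
  set A := Y.filter fun e => k ≤ (Y.filter fun y => u e < u y).card with hA
  set B := Y.filter fun e => (Y.filter fun y => u e ≤ u y).card < k with hB
  have hAY : A ⊆ Y := Finset.filter_subset _ _
  have hBY : B ⊆ Y := Finset.filter_subset _ _
  have hdisj : Disjoint A B := by
    rw [Finset.disjoint_left]
    intro e h1 h2
    have h3 := (Finset.mem_filter.1 h1).2
    have h4 := (Finset.mem_filter.1 h2).2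
    have h5 : (Y.filter fun y => u e < u y).card ≤ (Y.filter fun y => u e ≤ u y).card :=
      Finset.card_le_card fun y hy => by
        rw [Finset.mem_filter] at hy ⊢; exact ⟨hy.1, hy.2.le⟩
    omega
  have hcard : A.card + B.card ≤ Y.card := by
    rw [← Finset.card_union_of_disjoint hdisj]
    exact Finset.card_le_card (Finset.union_subset hAY hBY)
  have hAs : ∑ e ∈ A, (Y.filter fun y => u e < u y).card +
      ∑ e ∈ A, (A.filter fun y => -u e ≤ -u y).card ≤ A.card * Y.card := by
    rw [← Finset.sum_add_distrib, ← smul_eq_mul, ← Finset.sum_const]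
    refine Finset.sum_le_sum fun e _ => ?_
    rw [← Finset.card_union_of_disjoint]
    · exact Finset.card_le_card (Finset.union_subset (Finset.filter_subset _ _)
        ((Finset.filter_subset _ _).trans hAY))
    · rw [Finset.disjoint_left]
      intro y h1 h2
      have := (Finset.mem_filter.1 h1).2
      have := (Finset.mem_filter.1 h2).2
      linarith
  have hBs : ∑ e ∈ B, (Y \ Y.filter fun y => u e ≤ u y).card +
      ∑ e ∈ B, (B.filter fun y => u e ≤ u y).card ≤ B.card * Y.card := by
    rw [← Finset.sum_add_distrib, ← smul_eq_mul, ← Finset.sum_const]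
    refine Finset.sum_le_sum fun e _ => ?_
    rw [← Finset.card_union_of_disjoint]
    · exact Finset.card_le_card (Finset.union_subset Finset.sdiff_subset
        ((Finset.filter_subset _ _).trans hBY))
    · rw [Finset.disjoint_left]
      intro y h1 h2
      rw [Finset.mem_sdiff, Finset.mem_filter] at h1
      exact h1.2 ⟨h1.1, (Finset.mem_filter.1 h2).2⟩
  have hsum : ∑ e ∈ Y, pivotRest u Y k e ≤ ∑ e ∈ A, (Y.filter fun y => u e < u y).card +
      ∑ e ∈ B, (Y \ Y.filter fun y => u e ≤ u y).card := by
    rw [hA, hB, Finset.sum_filter, Finset.sum_filter, ← Finset.sum_add_distrib]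
    refine Finset.sum_le_sum fun e _ => ?_
    unfold pivotRest
    split_ifs <;> omega
  have hA2 := sq_card_le_two_mul_sum_card_filter A (fun e => -u e)
  have hB2 := sq_card_le_two_mul_sum_card_filter B u
  zify at *
  nlinarith [sq_nonneg ((A.card : ℤ) - B.card), sq_nonneg ((Y.card : ℤ) - A.card - B.card),
    mul_nonneg (sub_nonneg.2 hcard) (sub_nonneg.2 hcard)]

end Partition


/-! ### Quickselect by demand queries -/

section Selection

variable {m : ℕ} {v : SetFun m}

/-- Some set of size `n` between `s` and `t`. -/
noncomputable def between (s t : Finset (Fin m)) (n : ℕ) : Finset (Fin m) :=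
  Classical.epsilon fun u => s ⊆ u ∧ u ⊆ t ∧ u.card = n

lemma between_spec {s t : Finset (Fin m)} {n : ℕ} (hst : s ⊆ t) (hs : s.card ≤ n)
    (ht : n ≤ t.card) :
    s ⊆ between s t n ∧ between s t n ⊆ t ∧ (between s t n).card = n :=
  Classical.epsilon_spec (p := fun u => s ⊆ u ∧ u ⊆ t ∧ u.card = n)
    (Finset.exists_subsuperset_card_eq hst hs ht)

/-- The price `p` on the items of `Y`, and a price above `V` on all other items. -/
noncomputable def priceOn (Y : Finset (Fin m)) (p V : ℝ) : Fin m → ℝ≥0 :=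
  fun i => if i ∈ Y then p.toNNReal else (V + 1).toNNReal

/-- Items outside `Y` cost more than everything is worth, and on `Y` the valuation is additive, so
each item is judged on its own. As no item is worth exactly `p`, there are no ties. -/
lemma inter_eq_of_isDemanded_priceOn (hv : IsWeightedMatroidRank v) {Y G : Finset (Fin m)} {p : ℝ}
    (hadd : ∀ A ⊆ Y, v A = ∑ a ∈ A, v {a}) (hp : 0 ≤ p) (hne : ∀ y ∈ Y, v {y} ≠ p)
    (hG : IsDemanded v (priceOn Y p (v Finset.univ)) G) :
    G ∩ Y = Y.filter fun y => p < v {y} := by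
  have hVn := hv.nonneg Finset.univ
  have hGY : G ⊆ Y := by
    intro i hi
    by_contra hiY
    have h := hG (G.erase i)
    have h1 := Finset.add_sum_erase G (fun i => (priceOn Y p (v Finset.univ) i : ℝ)) hi
    have h2 : (priceOn Y p (v Finset.univ) i : ℝ) = v Finset.univ + 1 := by
      simp only [priceOn, if_neg hiY]
      exact Real.coe_toNNReal _ (by linarith)
    have h3 := hv.nonneg (G.erase i)
    have h4 := hv.mono (Finset.subset_univ G)
    linarith
  have hpr : ∀ y ∈ Y, (priceOn Y p (v Finset.univ) y : ℝ) = p := fun y hy => by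
    simp only [priceOn, if_pos hy]
    exact Real.coe_toNNReal _ hp
  rw [Finset.inter_eq_left.2 hGY]
  ext y
  rw [Finset.mem_filter]
  constructor
  · intro hy
    refine ⟨hGY hy, ?_⟩
    have h := hG (G.erase y)
    have h1 := Finset.add_sum_erase G (fun i => (priceOn Y p (v Finset.univ) i : ℝ)) hy
    have h2 := Finset.add_sum_erase G (fun i => v {i}) hy
    rw [hadd G hGY, hadd _ ((Finset.erase_subset _ _).trans hGY)] at h
    have h3 := hpr y (hGY hy)
    exact lt_of_le_of_ne (by linarith) (hne y (hGY hy)).symm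
  · rintro ⟨hyY, hlt⟩
    by_contra hyG
    have h := hG (insert y G)
    rw [hadd G hGY, hadd _ (Finset.insert_subset hyY hGY), Finset.sum_insert hyG,
      Finset.sum_insert hyG, hpr y hyY] at h
    linarith

/-- Quickselect: given the set `H` of items already taken, find the `k` most valuable items of `Y`
and hand all these items and a separating price over to `fin`. -/
noncomputable def select (V η : ℝ) (fb : QueryAlg m) (fin : Finset (Fin m) → ℝ≥0 → QueryAlg m) :
    ℕ → Finset (Fin m) → Finset (Fin m) → ℕ → QueryAlg m
  | 0, _, _, _ => fb
  | n + 1, H, Y, k =>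
    -- The condition says that `Y` is nonempty, and it casts the outcomes of `rand` to positions in
    -- `Y`.
    if h : Y.card - 1 + 1 = Y.card then
      .rand (Y.card - 1) fun i =>
        .value {(Y.equivFin.symm (Fin.cast h i)).1} fun x =>
          .demand (priceOn Y (x + η) V) fun G _ =>
            if k ≤ (G ∩ Y).card then select V η fb fin n H (G ∩ Y) k
            else .demand (priceOn Y (x - η) V) fun E _ =>
              if (E ∩ Y).card < k then
                select V η fb fin n (H ∪ (E ∩ Y)) (Y \ (E ∩ Y)) (k - (E ∩ Y).card)
              else fin (H ∪ between (G ∩ Y) (E ∩ Y) k) x.toNNReal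
    else fb

/-- Nothing is claimed about the selected set: `fin` has to cope with any candidate, so no gap is
needed. -/
lemma select_alwaysReturns {V η : ℝ} {fb : QueryAlg m} {fin : Finset (Fin m) → ℝ≥0 → QueryAlg m}
    {P : Finset (Fin m) → Prop} (hfb : fb.AlwaysReturns v P)
    (hfin : ∀ A p, (fin A p).AlwaysReturns v P) (n : ℕ) (H Y : Finset (Fin m)) (k : ℕ) :
    (select V η fb fin n H Y k).AlwaysReturns v P := by
  induction n generalizing H Y k with
  | zero => exact hfb
  | succ n ih =>
    unfold select
    split_ifs with h
    · intro i G _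
      dsimp only
      split_ifs with hk
      · exact ih _ _ _
      · intro E _
        dsimp only
        split_ifs with hE
        · exact ih _ _ _
        · exact hfin _ _
    · exact hfb

lemma select_expectedQueries_le {V η : ℝ} {fb : QueryAlg m}
    {fin : Finset (Fin m) → ℝ≥0 → QueryAlg m} {b : ℝ≥0∞} (hfb : fb.expectedQueries v ≤ b)
    (hfin : ∀ A p, (fin A p).expectedQueries v ≤ b) (n : ℕ) (H Y : Finset (Fin m)) (k : ℕ) :
    (select V η fb fin n H Y k).expectedQueries v ≤ (3 * n : ℕ) + b := by
  induction n generalizing H Y k with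
  | zero => simpa [select] using hfb
  | succ n ih =>
    have hb : b ≤ (3 * n : ℕ) + b := le_add_self
    have e : ((3 * (n + 1) : ℕ) : ℝ≥0∞) + b = 1 + (1 + (1 + ((3 * n : ℕ) + b))) := by
      push_cast; ring
    rw [e]
    unfold select
    split_ifs with h
    · refine QueryAlg.expectedQueries_rand_le_const fun i => ?_
      refine QueryAlg.expectedQueries_value_le ?_
      refine QueryAlg.expectedQueries_demand_le fun G _ => ?_
      split_ifs with hk
      · exact (ih _ _ _).trans le_add_self
      · refine QueryAlg.expectedQueries_demand_le fun E _ => ?_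
        split_ifs with hE
        · exact ih _ _ _
        · exact (hfin _ _).trans hb
    · exact hfb.trans (hb.trans (le_add_self.trans (le_add_self.trans le_add_self)))

/-- `A` consists of `q` items of `X` which are worth at least `p`, and the other items of `X` are
worth at most `p`. -/
structure IsUpperPart (v : SetFun m) (X : Finset (Fin m)) (q : ℕ) (A : Finset (Fin m)) (p : ℝ≥0) :
    Prop where
  subset : A ⊆ X
  card_eq : A.card = q
  le : ∀ a ∈ A, (p : ℝ) ≤ v {a}
  ge : ∀ z ∈ X, z ∉ A → v {z} ≤ p

/-- All positive values of items, and all positive differences of such values, exceed `η`. -/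
def HasGap (η : ℝ) (v : SetFun m) : Prop :=
  (∀ i, 0 < v {i} → η < v {i}) ∧ ∀ i j, v {i} < v {j} → v {i} + η < v {j}

/-- Linearizing the logarithm by `log t ≤ t - 1` allows the remaining sizes to be averaged over the
pivots. -/
lemma log_le_log_add {a b : ℕ} (ha : 0 < a) (hb : 0 < b) :
    12 + 12 * Real.log a ≤ 12 * Real.log b + 12 * (a / b) := by
  have ha' : (0 : ℝ) < a := by exact_mod_cast ha
  have hb' : (0 : ℝ) < b := by exact_mod_cast hb
  have h := Real.log_le_sub_one_of_pos (div_pos ha' hb')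
  rw [Real.log_div ha'.ne' hb'.ne'] at h
  linarith

/-- Since `η` is below all gaps, the prices `x + η` and `x - η` isolate the items strictly above the
pivot and those at least as good. The invariant is that `X` splits into `H`, `Y` and the rest in
decreasing order of value, and `n` rounds suffice because the pivot always leaves `Y`. -/
lemma select_expectedQueries_le_of_isGreedyBase (hv : IsWeightedMatroidRank v)
    {X : Finset (Fin m)} (hX : IsGreedyBase v X) {η : ℝ} (hη : 0 < η) (hgap : HasGap η v)
    {fb : QueryAlg m} {fin : Finset (Fin m) → ℝ≥0 → QueryAlg m} {b : ℝ≥0∞} {q : ℕ}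
    (hfin : ∀ A p, IsUpperPart v X q A p → (fin A p).expectedQueries v ≤ b)
    (n : ℕ) (H Y : Finset (Fin m)) (k : ℕ) (hn : Y.card ≤ n) (hk : 1 ≤ k) (hkY : k ≤ Y.card)
    (hHX : H ⊆ X) (hYX : Y ⊆ X) (hHY : Disjoint H Y) (hq : H.card + k = q)
    (hH : ∀ h ∈ H, ∀ y ∈ Y, v {y} ≤ v {h})
    (hZ : ∀ z ∈ X, z ∉ H → z ∉ Y → ∀ y ∈ Y, v {z} ≤ v {y}) :
    (select (v Finset.univ) η fb fin n H Y k).expectedQueries v ≤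
      ENNReal.ofReal (12 + 12 * Real.log Y.card) + b := by
  induction n generalizing H Y k with
  | zero => omega
  | succ n ih =>
    have hcard : Y.card - 1 + 1 = Y.card := by omega
    have hYpos : (0 : ℝ) < Y.card := by exact_mod_cast (by omega : 0 < Y.card)
    have hlog : 0 ≤ Real.log Y.card := Real.log_natCast_nonneg _
    have haddY : ∀ A ⊆ Y, v A = ∑ a ∈ A, v {a} := fun A hA => hX.additive A (hA.trans hYX)
    set u : Fin m → ℝ := fun i => v {i} with hu
    -- Three queries for this round plus the linearized bound for the rest. The average over the
    -- pivots is at most `3 + 12 log |Y| + 12 · 3/4`, which reproduces the claimed bound.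
    set c : Fin m → ℝ := fun e => 3 + (12 * Real.log Y.card + 12 * (pivotRest u Y k e / Y.card))
      with hc
    have hc0 : ∀ e, 0 ≤ c e := fun e => by positivity
    unfold select
    rw [dif_pos hcard]
    refine QueryAlg.expectedQueries_rand_le
      (fun i => ENNReal.ofReal (c (Y.equivFin.symm (Fin.cast hcard i)).1) + b) (fun i => ?_) ?_
    · obtain ⟨e, heY⟩ := Y.equivFin.symm (Fin.cast hcard i)
      dsimp only
      have hG : ∀ G, IsDemanded v (priceOn Y (v {e} + η) (v Finset.univ)) G →
          G ∩ Y = Y.filter fun y => u e < u y := by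
        intro G hG
        rw [inter_eq_of_isDemanded_priceOn hv haddY (by linarith [hX.pos e (hYX heY)]) _ hG]
        · refine Finset.filter_congr fun y _ => ⟨fun h => ?_, fun h => hgap.2 _ _ h⟩
          change v {e} < v {y}
          linarith
        · intro y _ h
          have := hgap.2 e y (by linarith)
          linarith
      have hE : ∀ E, IsDemanded v (priceOn Y (v {e} - η) (v Finset.univ)) E →
          E ∩ Y = Y.filter fun y => u e ≤ u y := by
        intro E hE
        rw [inter_eq_of_isDemanded_priceOn hv haddY
          (by linarith [hgap.1 e (hX.pos e (hYX heY))]) _ hE]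
        · refine Finset.filter_congr fun y _ => ⟨fun h => ?_, fun h => ?_⟩
          · by_contra! hlt
            have := hgap.2 y e hlt
            linarith
          · change v {e} ≤ v {y} at h
            linarith
        · intro y _ h
          have := hgap.2 y e (by linarith)
          linarith
      have hsplit : ENNReal.ofReal (c e) + b = 1 + (1 + (1 + (ENNReal.ofReal
          (12 * Real.log Y.card + 12 * (pivotRest u Y k e / Y.card)) + b))) := by
        simp only [hc]
        rw [ENNReal.ofReal_add (by norm_num) (by positivity)]
        have : ENNReal.ofReal 3 = 1 + 1 + 1 := by norm_num
        rw [this]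
        ring
      rw [hsplit]
      refine QueryAlg.expectedQueries_value_le ?_
      refine QueryAlg.expectedQueries_demand_le fun G hGd => ?_
      rw [hG G hGd]
      set Gs := Y.filter fun y => u e < u y with hGs
      have hGsY : Gs ⊆ Y := Finset.filter_subset _ _
      have heG : e ∉ Gs := by simp [hGs]
      split_ifs with hkG
      · have hlt : Gs.card < Y.card :=
          Finset.card_lt_card ⟨hGsY, fun h => heG (h heY)⟩
        refine (ih H Gs k (by omega) hk hkG hHX (hGsY.trans hYX) (hHY.mono_right hGsY) hq
          (fun h hh y hy => hH h hh y (hGsY hy)) ?_).trans (le_add_left ?_)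
        · intro z hz hzH hzG y hy
          by_cases hzY : z ∈ Y
          · have h1 : ¬ u e < u z := fun h => hzG (Finset.mem_filter.2 ⟨hzY, h⟩)
            have h2 := (Finset.mem_filter.1 hy).2
            change u z ≤ u y
            linarith
          · exact hZ z hz hzH hzY y (hGsY hy)
        · refine add_le_add (ENNReal.ofReal_le_ofReal ?_) le_rfl
          rw [show pivotRest u Y k e = Gs.card by unfold pivotRest; rw [if_pos hkG]]
          exact log_le_log_add (by omega) (by omega)
      · refine QueryAlg.expectedQueries_demand_le fun E hEd => ?_
        rw [hE E hEd]
        set Es := Y.filter fun y => u e ≤ u y with hEs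
        have hEsY : Es ⊆ Y := Finset.filter_subset _ _
        have heE : e ∈ Es := by simp [hEs, heY]
        have hcardE : (Y \ Es).card + Es.card = Y.card := Finset.card_sdiff_add_card_eq_card hEsY
        have hEpos : 0 < Es.card := Finset.card_pos.2 ⟨e, heE⟩
        have hGE : Gs ⊆ Es := fun y hy => by
          rw [hGs, Finset.mem_filter] at hy
          exact Finset.mem_filter.2 ⟨hy.1, hy.2.le⟩
        have hHE : Disjoint H Es := hHY.mono_right hEsY
        split_ifs with hkE
        · refine (ih (H ∪ Es) (Y \ Es) (k - Es.card) (by omega) (by omega) (by omega)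
            (Finset.union_subset hHX (hEsY.trans hYX)) (Finset.sdiff_subset.trans hYX) ?_ ?_
            ?_ ?_).trans ?_
          · exact Finset.disjoint_union_left.2
              ⟨hHY.mono_right Finset.sdiff_subset, Finset.disjoint_sdiff⟩
          · rw [Finset.card_union_of_disjoint hHE]
            omega
          · intro h hh y hy
            rw [Finset.mem_sdiff] at hy
            rcases Finset.mem_union.1 hh with hh | hh
            · exact hH h hh y hy.1
            · have h1 : ¬ u e ≤ u y := fun h => hy.2 (Finset.mem_filter.2 ⟨hy.1, h⟩)
              have h2 := (Finset.mem_filter.1 hh).2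
              change u y ≤ u h
              linarith
          · intro z hz hz1 hz2 y hy
            rw [Finset.mem_union, not_or] at hz1
            refine hZ z hz hz1.1 (fun hzY => hz2 (Finset.mem_sdiff.2 ⟨hzY, hz1.2⟩)) y
              (Finset.mem_sdiff.1 hy).1
          · refine add_le_add (ENNReal.ofReal_le_ofReal ?_) le_rfl
            rw [show pivotRest u Y k e = (Y \ Es).card by
              unfold pivotRest; rw [if_neg hkG, if_pos hkE]]
            exact log_le_log_add (by omega) (by omega)
        -- Here the value of the pivot is a separating price; ties at it are filled up arbitrarily.
        · obtain ⟨h1, h2, h3⟩ := between_spec hGE (le_of_not_ge hkG) (not_lt.1 hkE)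
          set A := between Gs Es k with hA
          have hpe : ((v {e}).toNNReal : ℝ) = v {e} := Real.coe_toNNReal _ (hv.nonneg _)
          refine (hfin _ _ ⟨?_, ?_, ?_, ?_⟩).trans le_add_self
          · exact Finset.union_subset hHX (h2.trans (hEsY.trans hYX))
          · rw [Finset.card_union_of_disjoint (hHE.mono_right h2), h3, hq]
          · intro a ha
            rw [hpe]
            rcases Finset.mem_union.1 ha with ha | ha
            · exact hH a ha e heY
            · exact (Finset.mem_filter.1 (h2 ha)).2
          · intro z hz hzA
            rw [hpe]
            rw [Finset.mem_union, not_or] at hzA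
            by_cases hzY : z ∈ Y
            · exact not_lt.1 fun h => hzA.2 (h1 (Finset.mem_filter.2 ⟨hzY, h⟩))
            · exact hZ z hz hzA.1 hzY e heY
    · have hsum : ∑ i : Fin (Y.card - 1 + 1), (ENNReal.ofReal
          (c (Y.equivFin.symm (Fin.cast hcard i)).1) + b) = ∑ e ∈ Y, (ENNReal.ofReal (c e) + b) := by
        rw [← Finset.sum_coe_sort Y]
        exact Fintype.sum_equiv ((finCongr hcard).trans Y.equivFin.symm) _ _ fun i => rfl
      rw [hsum, Finset.sum_add_distrib, ← ENNReal.ofReal_sum_of_nonneg fun e _ => hc0 e,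
        Finset.sum_const, nsmul_eq_mul, hcard, add_mul, mul_comm b]
      gcongr
      rw [← ENNReal.ofReal_natCast, ← ENNReal.ofReal_mul (by positivity)]
      refine ENNReal.ofReal_le_ofReal ?_
      have h4 := sum_pivotRest_le u Y k
      have h4' : 4 * ∑ e ∈ Y, (pivotRest u Y k e : ℝ) ≤ 3 * (Y.card : ℝ) ^ 2 := by
        exact_mod_cast h4
      simp only [hc, Finset.sum_add_distrib, Finset.sum_const, nsmul_eq_mul, ← Finset.mul_sum,
        ← Finset.sum_div]
      have h5 : (∑ e ∈ Y, (pivotRest u Y k e : ℝ)) / Y.card ≤ 3 / 4 * Y.card := by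
        rw [div_le_iff₀ hYpos]
        nlinarith
      linarith

end Selection


/-! ### Certified best bundles of a given size -/

section Evaluation

variable {m : ℕ} {v : SetFun m}

/-- `A` has size `q` and is demanded at some uniform item price; in particular, it is a best bundle
of its size. -/
def IsUniformlyDemanded (v : SetFun m) (q : ℕ) (A : Finset (Fin m)) : Prop :=
  A.card = q ∧ ∃ p : ℝ, 0 ≤ p ∧ ∀ S : Finset (Fin m), v S - p * S.card ≤ v A - p * q

/-- Continue with `A` and its value if `A` has size `q` and is demanded at the price `p`, and
otherwise run `fb`. -/
noncomputable def certify (fb : QueryAlg m) (q : ℕ) (next : Finset (Fin m) → ℝ → QueryAlg m)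
    (A : Finset (Fin m)) (p : ℝ≥0) : QueryAlg m :=
  .value A fun x => .demand (fun _ => p) fun S y =>
    if A.card = q ∧ y - p * S.card ≤ x - p * A.card then next A x else fb

/-- The demanded set has the largest profit at price `p`, so a candidate that passes the comparison
with it is itself demanded. -/
lemma certify_alwaysReturns {fb : QueryAlg m} {q : ℕ} {next : Finset (Fin m) → ℝ → QueryAlg m}
    {P : Finset (Fin m) → Prop} (hfb : fb.AlwaysReturns v P)
    (hnext : ∀ A, IsUniformlyDemanded v q A → (next A (v A)).AlwaysReturns v P)
    (A : Finset (Fin m)) (p : ℝ≥0) : (certify fb q next A p).AlwaysReturns v P := by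
  intro S hS
  dsimp only
  split_ifs with h
  · refine hnext A ⟨h.1, p, p.2, fun T => ?_⟩
    have := hS T
    simp only [Finset.sum_const, nsmul_eq_mul] at this
    rw [← h.1]
    nlinarith [h.2]
  · exact hfb

lemma certify_expectedQueries_le {fb : QueryAlg m} {q : ℕ}
    {next : Finset (Fin m) → ℝ → QueryAlg m} {b : ℝ≥0∞} (hfb : fb.expectedQueries v ≤ b)
    (hnext : ∀ A x, (next A x).expectedQueries v ≤ b) (A : Finset (Fin m)) (p : ℝ≥0) :
    (certify fb q next A p).expectedQueries v ≤ 2 + b := by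
  rw [show 2 + b = 1 + (1 + b) by ring]
  refine QueryAlg.expectedQueries_value_le (QueryAlg.expectedQueries_demand_le fun S _ => ?_)
  split_ifs
  exacts [hnext _ _, hfb]

lemma certify_expectedQueries_le_of_optimal {fb : QueryAlg m} {q : ℕ}
    {next : Finset (Fin m) → ℝ → QueryAlg m} {b : ℝ≥0∞}
    (hnext : ∀ A x, (next A x).expectedQueries v ≤ b) {A : Finset (Fin m)} {p : ℝ≥0}
    (hA : A.card = q) (hp : ∀ S : Finset (Fin m), v S - p * S.card ≤ v A - p * A.card) :
    (certify fb q next A p).expectedQueries v ≤ 2 + b := by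
  rw [show 2 + b = 1 + (1 + b) by ring]
  refine QueryAlg.expectedQueries_value_le (QueryAlg.expectedQueries_demand_le fun S _ => ?_)
  rw [if_pos ⟨hA, hp S⟩]
  exact hnext _ _

/-- Find a best bundle of size `q`, where `X` is a set demanded at a small uniform price. -/
noncomputable def evalSize (V η : ℝ) (X : Finset (Fin m)) (fb : QueryAlg m) (q : ℕ)
    (next : Finset (Fin m) → ℝ → QueryAlg m) : QueryAlg m :=
  if q = 0 then certify fb q next ∅ V.toNNReal
  else if X.card ≤ q then certify fb q next (between X Finset.univ q) 0
  else select V η fb (certify fb q next) m ∅ X q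

lemma evalSize_alwaysReturns {V η : ℝ} {X : Finset (Fin m)} {fb : QueryAlg m} {q : ℕ}
    {next : Finset (Fin m) → ℝ → QueryAlg m}
    {P : Finset (Fin m) → Prop} (hfb : fb.AlwaysReturns v P)
    (hnext : ∀ A, IsUniformlyDemanded v q A → (next A (v A)).AlwaysReturns v P) :
    (evalSize V η X fb q next).AlwaysReturns v P := by
  have h := certify_alwaysReturns hfb hnext
  unfold evalSize
  split_ifs
  exacts [h _ _, h _ _, select_alwaysReturns hfb h _ _ _ _]

/-- The evaluations of sizes take at most `e` queries on `v`. -/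
def EvalCostLE (v : SetFun m) (V η : ℝ) (X : Finset (Fin m)) (fb : QueryAlg m) (e : ℝ≥0∞) : Prop :=
  ∀ (q : ℕ) (next : Finset (Fin m) → ℝ → QueryAlg m) (b : ℝ≥0∞), q ≤ m →
    (∀ A x, (next A x).expectedQueries v ≤ b) →
    (evalSize V η X fb q next).expectedQueries v ≤ e + b

lemma evalCostLE_of_fallback {V η : ℝ} {X : Finset (Fin m)} {fb : QueryAlg m} {f : ℝ≥0∞}
    (hfb : fb.expectedQueries v ≤ f) : EvalCostLE v V η X fb ((3 * m : ℕ) + (2 + f)) := by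
  intro q next b _ hnext
  have h : ∀ A p, (certify fb q next A p).expectedQueries v ≤ 2 + (f + b) :=
    certify_expectedQueries_le (hfb.trans le_self_add) fun A x => (hnext A x).trans le_add_self
  have h' : fb.expectedQueries v ≤ 2 + (f + b) :=
    hfb.trans (le_self_add.trans le_add_self)
  rw [add_assoc, add_assoc 2]
  unfold evalSize
  split_ifs
  · exact (h _ _).trans le_add_self
  · exact (h _ _).trans le_add_self
  · exact select_expectedQueries_le h' h _ _ _ _

lemma evalCostLE_of_hasGap (hv : IsWeightedMatroidRank v) {η : ℝ} (hη : 0 < η) (hgap : HasGap η v)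
    {X : Finset (Fin m)} (hX : IsGreedyBase v X) (fb : QueryAlg m) :
    EvalCostLE v (v Finset.univ) η X fb (ENNReal.ofReal (14 + 12 * Real.log m)) := by
  intro q next b hqm hnext
  have hlogm : 0 ≤ Real.log m := Real.log_natCast_nonneg _
  have hsplit : ENNReal.ofReal (14 + 12 * Real.log m) + b =
      ENNReal.ofReal (12 + 12 * Real.log m) + (2 + b) := by
    rw [show (14 + 12 * Real.log m : ℝ) = (12 + 12 * Real.log m) + 2 by ring,
      ENNReal.ofReal_add (by positivity) (by norm_num), add_assoc]
    norm_num
  rw [hsplit]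
  unfold evalSize
  split_ifs with h0 hXq
  -- At the item price `v univ` no nonempty bundle beats the empty one.
  · refine (certify_expectedQueries_le_of_optimal hnext (by simp [h0]) fun S => ?_).trans le_add_self
    rw [Real.coe_toNNReal _ (hv.nonneg _), hv.empty]
    rcases S.eq_empty_or_nonempty with rfl | hS
    · simp [hv.empty]
    · have h1 : (1 : ℝ) ≤ S.card := by exact_mod_cast hS.card_pos
      have h2 := hv.mono (Finset.subset_univ S)
      have h3 := hv.nonneg (Finset.univ : Finset (Fin m))
      simp only [Finset.card_empty, Nat.cast_zero, mul_zero, sub_zero]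
      nlinarith
  -- `X` already attains the maximal value, so every superset of it is demanded at price zero.
  · obtain ⟨h1, -, h3⟩ := between_spec (Finset.subset_univ X) hXq (by simpa using hqm)
    refine (certify_expectedQueries_le_of_optimal hnext h3 fun S => ?_).trans le_add_self
    have h4 := hX.upper_optimal X subset_rfl 0 le_rfl (fun a ha => (hX.pos a ha).le)
      (fun z hz hz' => absurd hz hz') S
    have h5 := hv.mono h1
    simp only [zero_mul, sub_zero, NNReal.coe_zero] at h4 ⊢
    exact h4.trans h5
  · have hXm : X.card ≤ m := by simpa using X.card_le_univ
    refine (select_expectedQueries_le_of_isGreedyBase hv hX hη hgap (q := q) (b := 2 + b)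
      (fun A p hA => ?_) m ∅ X q hXm (by omega) (by omega) (by simp) subset_rfl (by simp) (by simp)
      (by simp) (fun z hz _ hz' => absurd hz hz')).trans ?_
    · exact certify_expectedQueries_le_of_optimal hnext hA.card_eq
        (hX.upper_optimal A hA.subset p p.2 hA.le hA.ge)
    · refine add_le_add (ENNReal.ofReal_le_ofReal ?_) le_rfl
      have : (0 : ℝ) < X.card := by exact_mod_cast (by omega : 0 < X.card)
      gcongr

end Evaluation

/-! ### Offered sizes in order, and price windows -/

section MenuOrder

variable {m : ℕ}

/-- The offered sizes in increasing order. -/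
noncomputable def BundleSizeMenu.nthSize (M : BundleSizeMenu m) (k : ℕ) : ℕ :=
  if h : k < M.sizes.card then M.sizes.orderEmbOfFin rfl ⟨k, h⟩ else 0

/-- The price of the `k`-th offered size. -/
noncomputable def BundleSizeMenu.nthPrice (M : BundleSizeMenu m) (k : ℕ) : ℝ :=
  M.price (M.nthSize k)

namespace BundleSizeMenu

variable (M : BundleSizeMenu m)

lemma nthSize_mem (k : ℕ) : M.nthSize k ∈ M.sizes := by
  unfold nthSize
  split_ifs with h
  exacts [Finset.orderEmbOfFin_mem _ _ _, M.zero_mem]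

lemma nthSize_le (k : ℕ) : M.nthSize k ≤ m := M.sizes_le _ (M.nthSize_mem k)

lemma nthSize_lt {i j : ℕ} (hij : i < j) (hj : j < M.sizes.card) : M.nthSize i < M.nthSize j := by
  unfold nthSize
  rw [dif_pos (hij.trans hj), dif_pos hj]
  exact (M.sizes.orderEmbOfFin rfl).strictMono hij

lemma exists_nthSize {q : ℕ} (hq : q ∈ M.sizes) : ∃ k < M.sizes.card, M.nthSize k = q := by
  have : q ∈ Set.range (M.sizes.orderEmbOfFin rfl) := by
    rw [Finset.range_orderEmbOfFin]; exact hq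
  obtain ⟨k, hk⟩ := this
  exact ⟨k, k.2, by unfold nthSize; rw [dif_pos k.2]; exact hk⟩

lemma nthSize_zero : M.nthSize 0 = 0 := by
  obtain ⟨k, hk, h⟩ := M.exists_nthSize M.zero_mem
  rcases Nat.eq_zero_or_pos k with rfl | h0
  · exact h
  · have := M.nthSize_lt h0 hk
    omega

lemma nthPrice_zero : M.nthPrice 0 = 0 := by
  rw [nthPrice, nthSize_zero, M.price_zero]

lemma price_nonneg {q : ℕ} (hq : q ∈ M.sizes) : 0 ≤ M.price q :=
  M.price_zero ▸ M.strictMono.monotoneOn M.zero_mem hq (Nat.zero_le q)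

lemma nthPrice_nonneg (k : ℕ) : 0 ≤ M.nthPrice k := M.price_nonneg (M.nthSize_mem k)

lemma nthPrice_le {i j : ℕ} (hij : i ≤ j) (hj : j < M.sizes.card) :
    M.nthPrice i ≤ M.nthPrice j := by
  rcases hij.eq_or_lt with rfl | h
  · exact le_rfl
  · exact (M.strictMono (M.nthSize_mem i) (M.nthSize_mem j) (M.nthSize_lt h hj)).le

lemma card_sizes_pos : 0 < M.sizes.card := Finset.card_pos.2 ⟨0, M.zero_mem⟩

lemma card_sizes_le : M.sizes.card ≤ m + 1 := by
  have h : M.sizes ⊆ Finset.range (m + 1) := fun q hq =>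
    Finset.mem_range.2 (Nat.lt_succ_of_le (M.sizes_le q hq))
  simpa using Finset.card_le_card h

/-- The positions of the sizes with a price in `[L / m, 2 * L]`, and of the largest size with a
price below `L / m`. -/
noncomputable def window (L : ℝ) : Finset ℕ :=
  (Finset.range M.sizes.card).filter fun j =>
    (L / m ≤ M.nthPrice j ∧ M.nthPrice j ≤ 2 * L) ∨
      (M.nthPrice j < L / m ∧ ∀ i < M.sizes.card, M.nthPrice i < L / m → i ≤ j)

lemma card_window_le {N : ℕ}
    (hN : ∀ L : ℝ, (M.sizes.filter fun q => L / m ≤ M.price q ∧ M.price q ≤ 2 * L).card ≤ N)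
    (L : ℝ) : (M.window L).card ≤ N + 1 := by
  unfold window
  rw [Finset.filter_or]
  refine (Finset.card_union_le _ _).trans (add_le_add ((Finset.card_le_card_of_injOn M.nthSize
    ?_ ?_).trans (hN L)) ?_)
  · intro j hj
    rw [Finset.mem_coe, Finset.mem_filter] at hj ⊢
    exact ⟨M.nthSize_mem j, hj.2⟩
  · intro i hi j hj h
    rw [Finset.mem_coe, Finset.mem_filter, Finset.mem_range] at hi hj
    by_contra hne
    rcases lt_or_gt_of_ne hne with h' | h'
    · exact (M.nthSize_lt h' hj.1).ne h
    · exact (M.nthSize_lt h' hi.1).ne h.symm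
  · rw [Finset.card_le_one]
    intro i hi j hj
    rw [Finset.mem_filter, Finset.mem_range] at hi hj
    exact le_antisymm (hj.2.2 i hi.1 hi.2.1) (hi.2.2 j hj.1 hj.2.1)

end BundleSizeMenu

end MenuOrder

/-! ### Locating an optimal size -/

section Search

variable {m : ℕ} {v : SetFun m}

/-- If the loss `v univ - v A` of the best bundles `A` of the `lo`-th size is at least their price,
and the loss of those of the next size is less than their price, then one of the sizes in a window
is optimal. -/
lemma le_of_window (hv : IsWeightedMatroidRank v) (M : BundleSizeMenu m) {lo : ℕ}
    (hlo : lo < M.sizes.card) {A : Finset (Fin m)}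
    (hA : IsUniformlyDemanded v (M.nthSize lo) A)
    (hAlo : M.nthPrice lo ≤ v Finset.univ - v A)
    (hhi : lo + 1 < M.sizes.card → ∃ A', IsUniformlyDemanded v (M.nthSize (lo + 1)) A' ∧
      v Finset.univ - v A' < M.nthPrice (lo + 1))
    {L u : ℝ} (hL : L = if lo + 1 < M.sizes.card then
      min (v Finset.univ - v A) (M.nthPrice (lo + 1)) else v Finset.univ - v A)
    (hu : v A - M.nthPrice lo ≤ u)
    (hwin : ∀ j ∈ M.window L, ∃ A', IsUniformlyDemanded v (M.nthSize j) A' ∧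
      v A' - M.nthPrice j ≤ u)
    {S : Finset (Fin m)} (hS : S.card ∈ M.sizes) : v S - M.price S.card ≤ u := by
  obtain ⟨j, hj, hjS⟩ := M.exists_nthSize hS
  rw [← hjS]
  change v S - M.nthPrice j ≤ u
  have hVA : 0 ≤ v Finset.univ - v A := sub_nonneg.2 (hv.mono (Finset.subset_univ A))
  have hLA : L ≤ v Finset.univ - v A := by
    rw [hL]; split_ifs
    exacts [min_le_left _ _, le_rfl]
  have hL0 : 0 ≤ L := by
    rw [hL]; split_ifs
    exacts [le_min hVA (M.nthPrice_nonneg _), hVA]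
  have hLm : L / m ≤ L := by
    rcases Nat.eq_zero_or_pos m with h | h
    · simpa [h] using hL0
    · exact div_le_self hL0 (by exact_mod_cast h)
  have hLhi : lo + 1 < M.sizes.card → L ≤ M.nthPrice (lo + 1) := fun h => by
    rw [hL, if_pos h]; exact min_le_right _ _
  rcases lt_or_ge (M.nthPrice j) (L / m) with hlt | hge
  · obtain ⟨k, hk, hkmax⟩ := ((Finset.range M.sizes.card).filter
      fun i => M.nthPrice i < L / m).exists_max_image id
        ⟨j, Finset.mem_filter.2 ⟨Finset.mem_range.2 hj, hlt⟩⟩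
    rw [Finset.mem_filter, Finset.mem_range] at hk
    have hjk : j ≤ k := hkmax j (Finset.mem_filter.2 ⟨Finset.mem_range.2 hj, hlt⟩)
    obtain ⟨B, ⟨hBc, p, hp, hB⟩, hBu⟩ := hwin k (Finset.mem_filter.2
      ⟨Finset.mem_range.2 hk.1, Or.inr ⟨hk.2, fun i hi h =>
        hkmax i (Finset.mem_filter.2 ⟨Finset.mem_range.2 hi, h⟩)⟩⟩)
    have hBS := hB S
    rw [← hjS] at hBS
    rcases hjk.eq_or_lt with rfl | hjk
    · linarith
    · have hsz : (M.nthSize j : ℝ) + 1 ≤ M.nthSize k := by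
        exact_mod_cast M.nthSize_lt hjk hk.1
      -- From position `lo + 1` on, prices are at least `L ≥ L / m`.
      have hklo : k ≤ lo := by
        by_contra! h
        have h1 : lo + 1 < M.sizes.card := by omega
        have h2 := M.nthPrice_le (show lo + 1 ≤ k by omega) hk.1
        have h3 := hLhi h1
        linarith [hk.2]
      have hBV := hB Finset.univ
      rw [Finset.card_univ, Fintype.card_fin] at hBV
      have hBA : v B ≤ v A := by
        obtain ⟨-, p', hp', hA'⟩ := hA
        have h1 := hA' B
        have h2 : (B.card : ℝ) ≤ M.nthSize lo := by
          have h3 : M.nthSize k ≤ M.nthSize lo := by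
            rcases hklo.eq_or_lt with rfl | h
            · exact le_rfl
            · exact (M.nthSize_lt h hlo).le
          rw [hBc]
          exact_mod_cast h3
        nlinarith
      have hmpos : (0 : ℝ) < m := by
        have := M.nthSize_le k
        have : 0 < m := by
          have h1 := M.nthSize_lt hjk hk.1
          omega
        exact_mod_cast this
      -- The full bundle is worth at least `L` more than `B` and has at most `m` additional items,
      -- which forces the supporting price `p` up to `L / m`. Going from size `j` to size `k`
      -- therefore gains at least `L / m`, more than the whole price of size `k`.
      have hpm : L / m ≤ p := by
        rw [div_le_iff₀ hmpos]
        have h1 : 0 ≤ p * M.nthSize k := by positivity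
        nlinarith
      have h1 := M.nthPrice_nonneg j
      nlinarith [hk.2]
  · rcases le_or_gt (M.nthPrice j) (2 * L) with hle | hgt
    · obtain ⟨B, ⟨-, p, hp, hB⟩, hBu⟩ := hwin j (Finset.mem_filter.2
        ⟨Finset.mem_range.2 hj, Or.inl ⟨hge, hle⟩⟩)
      have h1 := hB S
      rw [← hjS] at h1
      linarith
    -- A price above `2 * L` leaves a profit below `v univ - 2 * L`. Position `lo` does better if
    -- `L` is its loss, and position `lo + 1` if `L` is its price.
    · have h1 := hv.mono (Finset.subset_univ S)
      by_cases h : lo + 1 < M.sizes.card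
      · rw [if_pos h] at hL
        rcases le_total (v Finset.univ - v A) (M.nthPrice (lo + 1)) with h2 | h2
        · rw [min_eq_left h2] at hL
          linarith
        · rw [min_eq_right h2] at hL
          obtain ⟨B, ⟨hBc, -⟩, hB⟩ := hhi h
          obtain ⟨B', ⟨-, p', -, hB'⟩, hBu⟩ := hwin (lo + 1) (Finset.mem_filter.2
            ⟨Finset.mem_range.2 h, Or.inl ⟨hL ▸ hLm, by linarith [M.nthPrice_nonneg (lo + 1)]⟩⟩)
          have h3 := hB' B
          rw [hBc] at h3
          linarith
      · rw [if_neg h] at hL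
        linarith

variable (M : BundleSizeMenu m) (V η : ℝ) (X : Finset (Fin m)) (fb : QueryAlg m)

/-- Evaluate the sizes at the positions in a list, and return the best bundle found; `B` is the
best bundle so far, and `u` is its profit. -/
noncomputable def scan : List ℕ → Finset (Fin m) → ℝ → QueryAlg m
  | [], B, _ => .output B
  | j :: l, B, u => evalSize V η X fb (M.nthSize j) fun A x =>
      if u < x - M.nthPrice j then scan l A (x - M.nthPrice j) else scan l B u

/-- Evaluate the sizes in the window that belongs to the position `lo`. -/
noncomputable def scanWindow (lo : ℕ) : QueryAlg m :=
  evalSize V η X fb (M.nthSize lo) fun A x =>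
    scan M V η X fb (M.window (if lo + 1 < M.sizes.card then
      min (V - x) (M.nthPrice (lo + 1)) else V - x)).toList A (x - M.nthPrice lo)

/-- Binary search, in `t` rounds, for the position where the price exceeds the loss. -/
noncomputable def bisect : ℕ → ℕ → ℕ → QueryAlg m
  | 0, lo, _ => scanWindow M V η X fb lo
  | t + 1, lo, hi => evalSize V η X fb (M.nthSize ((lo + hi) / 2)) fun _ x =>
      if M.nthPrice ((lo + hi) / 2) ≤ V - x then bisect t ((lo + hi) / 2) hi
      else bisect t lo ((lo + hi) / 2)

variable {M V η X fb}

lemma scan_alwaysReturns {P : Finset (Fin m) → Prop} (hfb : fb.AlwaysReturns v P) (l : List ℕ)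
    (B : Finset (Fin m)) (u : ℝ) (hB : B.card ∈ M.sizes) (hu : u = v B - M.price B.card)
    (hP : ∀ B', B'.card ∈ M.sizes → u ≤ v B' - M.price B'.card →
      (∀ j ∈ l, ∃ A, IsUniformlyDemanded v (M.nthSize j) A ∧
        v A - M.nthPrice j ≤ v B' - M.price B'.card) → P B') :
    (scan M V η X fb l B u).AlwaysReturns v P := by
  induction l generalizing B u with
  | nil => exact hP B hB hu.le (by simp)
  | cons j l ih =>
    refine evalSize_alwaysReturns hfb fun A hA => ?_
    split_ifs with h
    · refine ih A _ (hA.1 ▸ M.nthSize_mem j) (by rw [hA.1]; rfl) fun B' h1 h2 h3 => ?_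
      refine hP B' h1 (h.le.trans h2) fun i hi => ?_
      rcases List.mem_cons.1 hi with rfl | hi
      exacts [⟨A, hA, h2⟩, h3 i hi]
    · refine ih B u hB hu fun B' h1 h2 h3 => hP B' h1 h2 fun i hi => ?_
      rcases List.mem_cons.1 hi with rfl | hi
      exacts [⟨A, hA, (not_lt.1 h).trans h2⟩, h3 i hi]

lemma scanWindow_alwaysReturns (hv : IsWeightedMatroidRank v)
    (hfb : fb.AlwaysReturns v (M.IsMostProfitable v)) {lo : ℕ}
    (hlt : lo < M.sizes.card)
    (hlo : ∃ A, IsUniformlyDemanded v (M.nthSize lo) A ∧ M.nthPrice lo ≤ v Finset.univ - v A)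
    (hhi : lo + 1 < M.sizes.card → ∃ A, IsUniformlyDemanded v (M.nthSize (lo + 1)) A ∧
      v Finset.univ - v A < M.nthPrice (lo + 1)) :
    (scanWindow M (v Finset.univ) η X fb lo).AlwaysReturns v (M.IsMostProfitable v) := by
  refine evalSize_alwaysReturns hfb fun A hA => ?_
  refine scan_alwaysReturns hfb _ A _ (hA.1 ▸ M.nthSize_mem lo) (by rw [hA.1]; rfl)
    fun B hB h1 h2 => ⟨hB, fun T hT => ?_⟩
  refine le_of_window hv M hlt hA ?_ hhi rfl h1 (fun j hj => h2 j (Finset.mem_toList.2 hj)) hT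
  obtain ⟨A', ⟨-, p', -, hA'⟩, h⟩ := hlo
  have := hA' A
  rw [hA.1] at this
  linarith

/-- The invariant is that the price is at most the loss at `lo` and exceeds it at `hi`, where `hi =
M.sizes.card` is a virtual position without a condition. -/
lemma bisect_alwaysReturns (hv : IsWeightedMatroidRank v)
    (hfb : fb.AlwaysReturns v (M.IsMostProfitable v)) (t lo hi : ℕ) (hlt : lo < hi)
    (hhin : hi ≤ M.sizes.card) (ht : hi ≤ lo + 2 ^ t)
    (hlo : ∃ A, IsUniformlyDemanded v (M.nthSize lo) A ∧ M.nthPrice lo ≤ v Finset.univ - v A)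
    (hhi : hi < M.sizes.card → ∃ A, IsUniformlyDemanded v (M.nthSize hi) A ∧
      v Finset.univ - v A < M.nthPrice hi) :
    (bisect M (v Finset.univ) η X fb t lo hi).AlwaysReturns v (M.IsMostProfitable v) := by
  induction t generalizing lo hi with
  | zero =>
    obtain rfl : hi = lo + 1 := by simp at ht; omega
    exact scanWindow_alwaysReturns hv hfb hhin hlo hhi
  | succ t ih =>
    refine evalSize_alwaysReturns hfb fun A hA => ?_
    rw [pow_succ] at ht
    have hpos : 0 < 2 ^ t := by positivity
    split_ifs with h
    · exact ih _ _ (by omega) hhin (by omega) ⟨A, hA, h⟩ hhi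
    · refine ih _ _ ?_ (by omega) (by omega) hlo fun _ => ⟨A, hA, not_le.1 h⟩
      -- With rounds to spare the midpoint can be `lo` itself. All best bundles of that size have
      -- the same value, so the invariant at `lo` excludes this branch.
      by_contra! hle
      have hmid : (lo + hi) / 2 = lo := by omega
      rw [hmid] at hA h
      obtain ⟨A', ⟨-, p, -, hA'⟩, h'⟩ := hlo
      have := hA' A
      rw [hA.1] at this
      linarith

lemma scan_expectedQueries_le {e : ℝ≥0∞} (he : EvalCostLE v V η X fb e) (l : List ℕ)
    (B : Finset (Fin m)) (u : ℝ) : (scan M V η X fb l B u).expectedQueries v ≤ l.length * e := by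
  induction l generalizing B u with
  | nil => simp [scan, QueryAlg.expectedQueries]
  | cons j l ih =>
    refine (he _ _ (l.length * e) (M.nthSize_le j) fun A x => ?_).trans ?_
    · split_ifs
      exacts [ih _ _, ih _ _]
    · rw [List.length_cons]; push_cast; rw [add_mul, one_mul, add_comm]

lemma scanWindow_expectedQueries_le {e : ℝ≥0∞} (he : EvalCostLE v V η X fb e) {N : ℕ}
    (hN : ∀ L, (M.window L).card ≤ N) (lo : ℕ) :
    (scanWindow M V η X fb lo).expectedQueries v ≤ (N + 1 : ℕ) * e := by
  refine (he _ _ (N * e) (M.nthSize_le lo) fun A x => ?_).trans ?_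
  · refine (scan_expectedQueries_le he _ _ _).trans ?_
    rw [Finset.length_toList]
    gcongr
    exact hN _
  · push_cast; rw [add_mul, one_mul, add_comm]

lemma bisect_expectedQueries_le {e : ℝ≥0∞} (he : EvalCostLE v V η X fb e) {N : ℕ}
    (hN : ∀ L, (M.window L).card ≤ N) (t lo hi : ℕ) :
    (bisect M V η X fb t lo hi).expectedQueries v ≤ (t + N + 1 : ℕ) * e := by
  induction t generalizing lo hi with
  | zero => simpa [bisect] using scanWindow_expectedQueries_le he hN lo
  | succ t ih =>
    refine (he _ _ ((t + N + 1 : ℕ) * e) (M.nthSize_le _) fun A x => ?_).trans ?_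
    · split_ifs
      exacts [ih _ _, ih _ _]
    · push_cast
      apply le_of_eq
      ring

variable (M) in
/-- The algorithm that finds a most profitable bundle of the menu `M`. It makes few queries in
expectation on every weighted matroid-rank valuation satisfying `HasGap η`. -/
noncomputable def findBundle (η : ℝ≥0) : QueryAlg m :=
  .value Finset.univ fun V => .demand (fun _ => η) fun X _ =>
    bisect M V η X (bruteForce M) (Nat.log 2 m + 1) 0 M.sizes.card

lemma findBundle_alwaysReturns (hv : IsWeightedMatroidRank v) (η : ℝ≥0) :
    (findBundle M η).AlwaysReturns v (M.IsMostProfitable v) := by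
  intro X _
  refine bisect_alwaysReturns hv (bruteForce_alwaysReturns M v) _ _ _ M.card_sizes_pos le_rfl ?_ ?_
    (fun h => absurd h (lt_irrefl _))
  · rw [zero_add]
    exact M.card_sizes_le.trans (Nat.succ_le_of_lt (Nat.lt_pow_succ_log_self (by norm_num) m))
  · have hV := hv.nonneg Finset.univ
    refine ⟨∅, ⟨by simp [M.nthSize_zero], v Finset.univ, hV, fun S => ?_⟩, ?_⟩
    · rw [M.nthSize_zero, hv.empty]
      rcases S.eq_empty_or_nonempty with rfl | hS
      · simp [hv.empty]
      · have h1 : (1 : ℝ) ≤ S.card := by exact_mod_cast hS.card_pos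
        have h2 := hv.mono (Finset.subset_univ S)
        simp only [Nat.cast_zero, mul_zero, sub_zero]
        nlinarith
    · rw [M.nthPrice_zero, hv.empty, sub_zero]
      exact hV

lemma findBundle_expectedQueries_le {η : ℝ≥0} {e : ℝ≥0∞} {N : ℕ}
    (he : ∀ X, IsDemanded v (fun _ => η) X → EvalCostLE v (v Finset.univ) η X (bruteForce M) e)
    (hN : ∀ L, (M.window L).card ≤ N) :
    (findBundle M η).expectedQueries v ≤ 2 + (Nat.log 2 m + N + 2 : ℕ) * e := by
  rw [show (2 : ℝ≥0∞) + (Nat.log 2 m + N + 2 : ℕ) * e =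
    1 + (1 + (Nat.log 2 m + 1 + N + 1 : ℕ) * e) by push_cast; ring]
  exact QueryAlg.expectedQueries_value_le (QueryAlg.expectedQueries_demand_le fun X hX =>
    bisect_expectedQueries_le (he X hX) hN _ _ _)

lemma findBundle_expectedQueries_le_of_hasGap (hv : IsWeightedMatroidRank v) {η : ℝ≥0} (hη : 0 < η)
    (hgap : HasGap η v) {N : ℕ} (hN : ∀ L, (M.window L).card ≤ N) :
    (findBundle M η).expectedQueries v ≤
      2 + (Nat.log 2 m + N + 2 : ℕ) * ENNReal.ofReal (14 + 12 * Real.log m) :=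
  findBundle_expectedQueries_le (fun _ hX => evalCostLE_of_hasGap hv hη hgap
    (isGreedyBase_of_isDemanded hv hη hgap.1 hX) _) hN

lemma findBundle_expectedQueries_le_of_fallback (v : SetFun m) (η : ℝ≥0) {N : ℕ}
    (hN : ∀ L, (M.window L).card ≤ N) :
    (findBundle M η).expectedQueries v ≤
      2 + (Nat.log 2 m + N + 2 : ℕ) * ((3 * m : ℕ) + (2 + (2 ^ m : ℕ))) :=
  findBundle_expectedQueries_le
    (fun _ _ => evalCostLE_of_fallback (bruteForce_expectedQueries_le M v)) hN

end Search


/-! ### Rounded and discounted menus -/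

section Rounding

variable {m : ℕ} (M : BundleSizeMenu m) {h β : ℝ}

/-- The exponent of the price of size `q`, rounded down to a power of `exp h`. -/
noncomputable def BundleSizeMenu.cell (h : ℝ) (q : ℕ) : ℤ := ⌊Real.log (M.price q) / h⌋

/-- Round the prices down to powers of `exp h`, discount them by the factor `1 - β`, and keep only
the largest of the sizes with the same rounded price. -/
noncomputable def BundleSizeMenu.rounded (hh : 0 < h) (hβ : β < 1) : BundleSizeMenu m where
  -- Size zero is treated separately, because its `cell` is a default value coming from `Real.log 0
  -- = 0`.
  sizes := M.sizes.filter fun q => q = 0 ∨ ∀ q' ∈ M.sizes, q < q' → M.cell h q < M.cell h q'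
  price q := if q = 0 then 0 else (1 - β) * Real.exp (h * M.cell h q)
  sizes_le q hq := M.sizes_le q (Finset.mem_filter.1 hq).1
  zero_mem := Finset.mem_filter.2 ⟨M.zero_mem, Or.inl rfl⟩
  price_zero := if_pos rfl
  strictMono := by
    intro q hq q' hq' hlt
    have hβ' : 0 < 1 - β := by linarith
    have hq'0 : q' ≠ 0 := by omega
    rw [Finset.mem_coe, Finset.mem_filter] at hq hq'
    dsimp only
    rw [if_neg hq'0]
    split_ifs with h0
    · positivity
    · have h1 : (M.cell h q : ℝ) < M.cell h q' := by
        exact_mod_cast hq.2.resolve_left h0 q' hq'.1 hlt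
      gcongr

namespace BundleSizeMenu

lemma price_pos {q : ℕ} (hq : q ∈ M.sizes) (h0 : q ≠ 0) : 0 < M.price q :=
  M.price_zero ▸ M.strictMono M.zero_mem hq (Nat.pos_of_ne_zero h0)

lemma exp_cell_le (hh : 0 < h) {q : ℕ} (hq : q ∈ M.sizes) (h0 : q ≠ 0) :
    Real.exp (h * M.cell h q) ≤ M.price q := by
  rw [← Real.le_log_iff_exp_le (M.price_pos hq h0), mul_comm, ← le_div_iff₀ hh]
  exact Int.floor_le _

lemma price_lt_exp_cell (hh : 0 < h) {q : ℕ} (hq : q ∈ M.sizes) (h0 : q ≠ 0) :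
    M.price q < Real.exp h * Real.exp (h * M.cell h q) := by
  rw [← Real.exp_add, ← Real.log_lt_iff_lt_exp (M.price_pos hq h0)]
  have h1 := Int.lt_floor_add_one (Real.log (M.price q) / h)
  rw [div_lt_iff₀ hh] at h1
  unfold cell
  linarith

lemma cell_mono (hh : 0 < h) {q q' : ℕ} (hq : q ∈ M.sizes) (hq' : q' ∈ M.sizes) (h0 : q ≠ 0)
    (hle : q ≤ q') : M.cell h q ≤ M.cell h q' := by
  unfold cell
  have h1 := M.strictMono.monotoneOn hq hq' hle
  have h2 := M.price_pos hq h0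
  gcongr

lemma exists_rounded_size (hh : 0 < h) (hβ : β < 1) {q : ℕ} (hq : q ∈ M.sizes) (h0 : q ≠ 0) :
    ∃ q' ∈ (M.rounded hh hβ).sizes, q ≤ q' ∧ M.cell h q' = M.cell h q := by
  obtain ⟨q', hq', hmax⟩ := (M.sizes.filter fun q' => q ≤ q' ∧ M.cell h q' = M.cell h q).exists_max_image
    id ⟨q, Finset.mem_filter.2 ⟨hq, le_rfl, rfl⟩⟩
  rw [Finset.mem_filter] at hq'
  refine ⟨q', Finset.mem_filter.2 ⟨hq'.1, Or.inr fun r hr hlt => ?_⟩, hq'.2⟩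
  refine lt_of_le_of_ne (M.cell_mono hh hq'.1 hr (by omega) hlt.le) fun he => ?_
  have := hmax r (Finset.mem_filter.2 ⟨hr, by omega, by rw [← he, hq'.2.2]⟩)
  simp only [id] at this
  omega

/-- Add the optimality of `S` in the old menu to that of `T` in the new one, compared with a
superset of `S` of a kept size in the same cell. The buyer's saving on `S`, at least `β` times its
price, is at most the saving on `T`, which is at most `(β + β^2) * g` for the rounded price `g` of
`T`. So the old price of `S` is at most `(1 + β) * g`, while `T` now costs `(1 - β) * g`. -/
lemma le_price_rounded {v : SetFun m} (hv : IsWeightedMatroidRank v) (hh : 0 < h) (hβ0 : 0 < β)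
    (hβ : β < 1) (hhβ : Real.exp h ≤ 1 + β ^ 2) {S T : Finset (Fin m)}
    (hS : M.IsMostProfitable v S) (hT : (M.rounded hh hβ).IsMostProfitable v T) :
    (1 - 2 * β) * M.price S.card ≤ (M.rounded hh hβ).price T.card := by
  set M' := M.rounded hh hβ with hM'
  have hT0 := M'.price_nonneg hT.1
  by_cases hS0 : S.card = 0
  · rw [hS0, M.price_zero, mul_zero]; exact hT0
  obtain ⟨q, hq, hle, hcell⟩ := M.exists_rounded_size hh hβ hS.1 hS0
  have hSpos := M.price_pos hS.1 hS0
  obtain ⟨S', hSS', -, hS'⟩ := Finset.exists_subsuperset_card_eq (Finset.subset_univ S) hle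
    (by simpa using M'.sizes_le q hq)
  have h1 := hT.2 S' (hS' ▸ hq)
  have h2 := hv.mono hSS'
  have hTM : T.card ∈ M.sizes := (Finset.mem_filter.1 hT.1).1
  have h3 := hS.2 T hTM
  have h4 : M'.price S'.card = (1 - β) * Real.exp (h * M.cell h S.card) := by
    rw [hS', ← hcell]; exact if_neg (by omega)
  have h5 := M.exp_cell_le hh hS.1 hS0
  have h6 : (1 - β) * Real.exp (h * M.cell h S.card) ≤ (1 - β) * M.price S.card := by
    gcongr
  by_cases hT1 : T.card = 0
  · rw [hT1, M'.price_zero] at h1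
    rw [hT1, M.price_zero] at h3
    nlinarith
  · have h7 : M'.price T.card = (1 - β) * Real.exp (h * M.cell h T.card) := if_neg hT1
    have h8 := M.price_lt_exp_cell hh hTM hT1
    rw [h7] at h1 ⊢
    set g := Real.exp (h * M.cell h T.card) with hg
    have hgpos : 0 < g := Real.exp_pos _
    have h9 : M.price T.card ≤ (1 + β ^ 2) * g := h8.le.trans (by gcongr)
    have h10 : β * M.price S.card ≤ (β + β ^ 2) * g := by nlinarith
    have h11 : M.price S.card ≤ (1 + β) * g := by
      refine le_of_mul_le_mul_left ?_ hβ0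
      linarith
    have h12 : (1 - 2 * β) * M.price S.card ≤ (1 - β) ^ 2 * M.price S.card := by
      have := sq_nonneg β
      gcongr
      nlinarith
    have h13 : (1 - β) ^ 2 * M.price S.card ≤ (1 - β) ^ 2 * ((1 + β) * g) := by gcongr
    have h14 : (1 - β) ^ 2 * ((1 + β) * g) ≤ (1 - β) * g := by
      have : 0 ≤ (1 - β) * g * β ^ 2 := by
        have : 0 < 1 - β := by linarith
        positivity
      nlinarith
    linarith

/-- Kept nonzero sizes have distinct cells, and the prices in question confine the cells to an
interval of length `log (2 * m) / h`. -/
lemma card_rounded_filter_le (hm : 1 ≤ m) (hh : 0 < h) (hβ : β < 1) (L : ℝ) :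
    ((M.rounded hh hβ).sizes.filter fun q => L / m ≤ (M.rounded hh hβ).price q ∧
      (M.rounded hh hβ).price q ≤ 2 * L).card ≤ ⌊Real.log (2 * m) / h⌋₊ + 1 := by
  set M' := M.rounded hh hβ with hM'
  have hm' : (0 : ℝ) < m := by exact_mod_cast hm
  rcases le_or_gt L 0 with hL | hL
  · refine (Finset.card_le_one.2 ?_).trans (Nat.le_add_left _ _)
    have key : ∀ q ∈ M'.sizes.filter (fun q => L / m ≤ M'.price q ∧ M'.price q ≤ 2 * L), q = 0 := by
      intro q hq
      rw [Finset.mem_filter] at hq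
      by_contra h0
      have := M'.price_pos hq.1 h0
      linarith [hq.2.2]
    intro q hq q' hq'
    rw [key q hq, key q' hq']
  · have hβ' : 0 < 1 - β := by linarith
    set a := Real.log (L / m / (1 - β)) / h with ha
    set b := Real.log (2 * L / (1 - β)) / h with hb
    have hab : b - a = Real.log (2 * m) / h := by
      rw [ha, hb, ← sub_div, ← Real.log_div (by positivity) (by positivity)]
      congr 2
      field_simp
    have hq0 : ∀ q ∈ M'.sizes.filter (fun q => L / m ≤ M'.price q ∧ M'.price q ≤ 2 * L), q ≠ 0 := by
      intro q hq h0
      rw [Finset.mem_filter, h0, M'.price_zero] at hq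
      have : 0 < L / m := by positivity
      linarith [hq.2.1]
    refine (Finset.card_le_card_of_injOn (t := Finset.Icc ⌈a⌉ ⌊b⌋) (M.cell h) ?_ ?_).trans ?_
    · intro q hq
      rw [Finset.mem_coe] at hq
      have h0 := hq0 q hq
      rw [Finset.mem_filter] at hq
      have hp : M'.price q = (1 - β) * Real.exp (h * M.cell h q) := if_neg h0
      rw [hp] at hq
      rw [Finset.mem_coe, Finset.mem_Icc, Int.ceil_le, Int.le_floor, ha, hb, div_le_iff₀ hh,
        le_div_iff₀ hh, Real.log_le_iff_le_exp (by positivity), Real.le_log_iff_exp_le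
        (by positivity), div_le_iff₀ hβ', le_div_iff₀ hβ', mul_comm _ h, mul_comm _ (1 - β)]
      exact hq.2
    · intro q hq q' hq' he
      rw [Finset.mem_coe] at hq hq'
      have h0 := hq0 q hq
      have h0' := hq0 q' hq'
      rw [Finset.mem_filter] at hq hq'
      have h1 := (Finset.mem_filter.1 hq.1)
      have h1' := (Finset.mem_filter.1 hq'.1)
      by_contra hne
      rcases lt_or_gt_of_ne hne with hl | hl
      · exact (h1.2.resolve_left h0 q' h1'.1 hl).ne he
      · exact (h1'.2.resolve_left h0' q h1.1 hl).ne he.symm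
    · rw [Int.card_Icc, ← hab]
      have h1 : ⌊b⌋ - ⌈a⌉ ≤ ⌊b - a⌋ := by
        rw [Int.le_floor]
        push_cast
        linarith [Int.floor_le b, Int.le_ceil a]
      have h2 : (⌊b - a⌋₊ : ℤ) = ⌊b - a⌋ := by
        rw [Int.natCast_floor_eq_floor]
        rw [hab]
        have : (1 : ℝ) ≤ m := by exact_mod_cast hm
        exact div_nonneg (Real.log_nonneg (by linarith)) hh.le
      omega

/-- The menu that offers nothing but the empty bundle. -/
def trivial (m : ℕ) : BundleSizeMenu m where
  sizes := {0}
  price _ := 0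
  sizes_le := by simp
  zero_mem := by simp
  price_zero := rfl
  strictMono := by simp

end BundleSizeMenu

end Rounding

/-! ### Comparing expected revenues -/

section Revenue

variable {m : ℕ} {M M' : BundleSizeMenu m}

/-- Couple the two rules by drawing both bundles independently. -/
lemma BuyerRule.revenueAt_le (β : BuyerRule M) (β' : BuyerRule M') {v : SetFun m} {r : ℝ}
    (h : ∀ S T, M.IsMostProfitable v S → M'.IsMostProfitable v T →
      r * M.price S.card ≤ M'.price T.card) :
    r * β.revenueAt v ≤ β'.revenueAt v := by
  have h1 : r * β.revenueAt v = ∑ S, ∑ T, r * M.price S.card * β.prob v S * β'.prob v T := by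
    simp_rw [← Finset.mul_sum, β'.sum_eq_one, mul_one, mul_assoc, ← Finset.mul_sum]
    rfl
  have h2 : β'.revenueAt v = ∑ S, ∑ T, M'.price T.card * β.prob v S * β'.prob v T := by
    rw [Finset.sum_comm]
    simp_rw [← Finset.sum_mul, ← Finset.mul_sum, β.sum_eq_one, mul_one]
    rfl
  rw [h1, h2]
  refine Finset.sum_le_sum fun S _ => Finset.sum_le_sum fun T _ => ?_
  by_cases hS : β.prob v S = 0
  · simp [hS]
  by_cases hT : β'.prob v T = 0
  · simp [hT]
  have := h S T (β.isMostProfitable v S hS) (β'.isMostProfitable v T hT)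
  have h3 := β.nonneg v S
  have h4 := β'.nonneg v T
  gcongr

lemma BuyerRule.revenueAt_nonneg (β : BuyerRule M) (v : SetFun m) : 0 ≤ β.revenueAt v := by
  refine Finset.sum_nonneg fun S _ => ?_
  by_cases hS : β.prob v S = 0
  · simp [hS]
  · exact mul_nonneg (M.price_nonneg (β.isMostProfitable v S hS).1) (β.nonneg v S)

lemma BuyerRule.revenue_nonneg (β : BuyerRule M) (D : Measure (SetFun m)) : 0 ≤ β.revenue D :=
  integral_nonneg β.revenueAt_nonneg

lemma BuyerRule.integrable_revenueAt (β : BuyerRule M) (D : Measure (SetFun m))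
    [IsProbabilityMeasure D] : Integrable β.revenueAt D := by
  refine Integrable.of_bound (C := ∑ S : Finset (Fin m), |M.price S.card|) ?_ ?_
  · refine Measurable.aestronglyMeasurable ?_
    exact Finset.measurable_sum _ fun S _ => (β.measurable S).const_mul _
  · refine Filter.Eventually.of_forall fun v => (norm_sum_le _ _).trans
      (Finset.sum_le_sum fun S _ => ?_)
    rw [norm_mul, Real.norm_eq_abs, Real.norm_eq_abs, abs_of_nonneg (β.nonneg v S)]
    refine mul_le_of_le_one_right (abs_nonneg _) ?_
    rw [← β.sum_eq_one v]
    exact Finset.single_le_sum (fun T _ => β.nonneg v T) (Finset.mem_univ S)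

lemma BuyerRule.revenue_le (β : BuyerRule M) (β' : BuyerRule M') (D : Measure (SetFun m))
    [IsProbabilityMeasure D] {r : ℝ}
    (h : ∀ᵐ v ∂D, ∀ S T, M.IsMostProfitable v S → M'.IsMostProfitable v T →
      r * M.price S.card ≤ M'.price T.card) :
    r * β.revenue D ≤ β'.revenue D := by
  unfold revenue
  rw [← integral_const_mul]
  refine integral_mono_ae ((β.integrable_revenueAt D).const_mul r) (β'.integrable_revenueAt D) ?_
  filter_upwards [h] with v hv
  exact β.revenueAt_le β' hv

end Revenue

/-! ### Gaps between item values -/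

section Gap

variable {m : ℕ}

lemma HasGap.mono {η η' : ℝ} {v : SetFun m} (h : HasGap η v) (hle : η' ≤ η) : HasGap η' v :=
  ⟨fun i hi => by linarith [h.1 i hi], fun i j hij => by linarith [h.2 i j hij]⟩

lemma measurableSet_hasGap (η : ℝ) : MeasurableSet {v : SetFun m | HasGap η v} := by
  have hc : ∀ i : Fin m, Measurable fun v : SetFun m => v {i} := fun i => measurable_pi_apply _
  have hlt : ∀ f g : SetFun m → ℝ, Measurable f → Measurable g → Measurable fun v => f v < g v :=
    fun f g hf hg => measurableSet_setOfPred.1 (measurableSet_lt hf hg)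
  refine measurableSet_setOfPred.2 (Measurable.and ?_ ?_)
  · exact Measurable.forall fun i =>
      (hlt _ _ measurable_const (hc i)).imp (hlt _ _ measurable_const (hc i))
  · exact Measurable.forall fun i => Measurable.forall fun j =>
      (hlt _ _ (hc i) (hc j)).imp (hlt _ _ ((hc i).add_const _) (hc j))

lemma exists_hasGap (v : SetFun m) : ∃ n : ℕ, HasGap (1 / ((n : ℝ) + 1)) v := by
  have ht := tendsto_one_div_add_atTop_nhds_zero_nat (𝕜 := ℝ)
  have h1 : ∀ᶠ n : ℕ in Filter.atTop, ∀ i, 0 < v {i} → 1 / ((n : ℝ) + 1) < v {i} := by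
    refine Filter.eventually_all.2 fun i => ?_
    by_cases hi : 0 < v {i}
    · filter_upwards [ht.eventually_lt_const hi] with n hn _ using hn
    · exact Filter.Eventually.of_forall fun n h => absurd h hi
  have h2 : ∀ᶠ n : ℕ in Filter.atTop, ∀ i j, v {i} < v {j} → v {i} + 1 / ((n : ℝ) + 1) < v {j} := by
    refine Filter.eventually_all.2 fun i => Filter.eventually_all.2 fun j => ?_
    by_cases hij : v {i} < v {j}
    · filter_upwards [ht.eventually_lt_const (sub_pos.2 hij)] with n hn _
      linarith
    · exact Filter.Eventually.of_forall fun n h => absurd h hij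
  obtain ⟨n, hn⟩ := (h1.and h2).exists
  exact ⟨n, hn⟩

/-- Every single valuation has some gap, as there are finitely many items. The exceptional sets thus
decrease to the empty set, and continuity from above applies. -/
lemma exists_measure_not_hasGap_le (D : Measure (SetFun m)) [IsProbabilityMeasure D] {δ : ℝ≥0∞}
    (hδ : 0 < δ) : ∃ η : ℝ≥0, 0 < η ∧ D {v | ¬ HasGap η v} ≤ δ := by
  have hanti : Antitone fun n : ℕ => {v : SetFun m | ¬ HasGap (1 / ((n : ℝ) + 1)) v} := by
    intro n n' hnn v hv hgap
    refine hv (hgap.mono ?_)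
    have : (n : ℝ) ≤ n' := by exact_mod_cast hnn
    gcongr
  have ht := tendsto_measure_iInter_atTop (μ := D)
    (fun n : ℕ => (measurableSet_hasGap (m := m) (1 / ((n : ℝ) + 1))).compl.nullMeasurableSet)
    hanti ⟨0, measure_ne_top _ _⟩
  have hempty : ⋂ n : ℕ, {v : SetFun m | ¬ HasGap (1 / ((n : ℝ) + 1)) v} = ∅ := by
    refine Set.eq_empty_of_forall_notMem fun v hv => ?_
    obtain ⟨n, hn⟩ := exists_hasGap v
    exact Set.mem_iInter.1 hv n hn
  rw [show (⋂ n : ℕ, {v : SetFun m | HasGap (1 / ((n : ℝ) + 1)) v}ᶜ) = ∅ from hempty,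
    measure_empty] at ht
  obtain ⟨n, hn⟩ := (ht.eventually_lt_const hδ).exists
  refine ⟨⟨1 / ((n : ℝ) + 1), by positivity⟩, ?_, hn.le⟩
  exact NNReal.coe_pos.1 (by change (0 : ℝ) < 1 / ((n : ℝ) + 1); positivity)

/-- The measurable majorant `a + w · 1_B` makes the measurability of `f` irrelevant. -/
lemma upperExpectation_le {Ω : Type} [MeasurableSpace Ω] (D : Measure Ω) [IsProbabilityMeasure D]
    {f : Ω → ℝ≥0∞} {B : Set Ω} (hB : MeasurableSet B) {a w : ℝ≥0∞}
    (hf : ∀ᵐ x ∂D, x ∉ B → f x ≤ a) (hw : ∀ x, f x ≤ w) :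
    upperExpectation D f ≤ a + w * D B := by
  refine (iInf₂_le (fun x => a + B.indicator (fun _ => w) x) (by fun_prop (disch := exact hB))).trans
    ((iInf_le _ ?_).trans ?_)
  · filter_upwards [hf] with x hx
    by_cases hxB : x ∈ B
    · rw [Set.indicator_of_mem hxB]
      exact (hw x).trans le_add_self
    · exact (hx hxB).trans le_self_add
  · rw [lintegral_add_left measurable_const, lintegral_indicator_const hB]
    simp

end Gap


/-! ### Numerical bounds and conclusion -/

section Main

/-- This uses `log (1 + x) ≥ x / (1 + x) ≥ x / 2` at `x = (ε / 2) ^ 2 ≤ 1`. -/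
lemma one_div_log_le {ε : ℝ} (hε : 0 < ε) (hε1 : ε < 1) :
    1 / Real.log (1 + (ε / 2) ^ 2) ≤ 8 * ε⁻¹ ^ 2 := by
  have hx : 0 < (ε / 2) ^ 2 := by positivity
  have h1 := Real.one_sub_inv_le_log_of_pos (show 0 < 1 + (ε / 2) ^ 2 by positivity)
  have h2 : ε ^ 2 / 8 ≤ 1 - (1 + (ε / 2) ^ 2)⁻¹ := by
    rw [le_sub_iff_add_le, ← le_sub_iff_add_le', inv_le_comm₀ (by positivity) (by nlinarith),
      inv_le_iff_one_le_mul₀ (by nlinarith)]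
    have h3 : 0 ≤ ε ^ 2 * (1 - ε ^ 2) := mul_nonneg (sq_nonneg _) (by nlinarith)
    nlinarith
  rw [show 8 * ε⁻¹ ^ 2 = 1 / (ε ^ 2 / 8) by field_simp]
  gcongr
  linarith

lemma query_bound {m : ℕ} (hm : 2 ≤ m) {ε : ℝ} (hε : 0 < ε) (hε1 : ε < 1) :
    3 + ((Nat.log 2 m : ℝ) + (⌊Real.log (2 * m) / Real.log (1 + (ε / 2) ^ 2)⌋₊ + 1 + 1 : ℕ) + 2) *
      (14 + 12 * Real.log m) ≤ 2000 * ε⁻¹ ^ 3 * Real.log m ^ 4 := by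
  set l := Real.log m with hl
  set i := ε⁻¹ with hi
  have hm' : (2 : ℝ) ≤ m := by exact_mod_cast hm
  have hi1 : 1 ≤ i := (one_le_inv₀ hε).2 hε1.le
  have hlog2 := Real.log_two_gt_d9
  have hl2 : Real.log 2 ≤ l := Real.log_le_log (by norm_num) hm'
  have hl1 : 1 ≤ 1.5 * l := by linarith
  have h1 : (Nat.log 2 m : ℝ) ≤ 1.5 * l := by
    have h := Real.log_le_log (by positivity)
      (show ((2 ^ Nat.log 2 m : ℕ) : ℝ) ≤ m by exact_mod_cast Nat.pow_log_le_self 2 (by omega))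
    rw [Nat.cast_pow, Real.log_pow] at h
    have : (0 : ℝ) ≤ Nat.log 2 m := Nat.cast_nonneg _
    push_cast at h
    nlinarith
  have hlogpos : 0 < Real.log (1 + (ε / 2) ^ 2) := Real.log_pos (by
    have : 0 < (ε / 2) ^ 2 := by positivity
    linarith)
  have h2m : Real.log (2 * m) ≤ 2 * l := by
    rw [Real.log_mul (by norm_num) (by positivity)]
    linarith
  have h2m0 : 0 ≤ Real.log (2 * m) := Real.log_nonneg (by linarith)
  have h2 : (⌊Real.log (2 * m) / Real.log (1 + (ε / 2) ^ 2)⌋₊ : ℝ) ≤ 2 * l * (8 * i ^ 2) := by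
    refine (Nat.floor_le (div_nonneg h2m0 hlogpos.le)).trans ?_
    rw [div_eq_mul_one_div]
    exact mul_le_mul h2m (one_div_log_le hε hε1) (by positivity) (by linarith)
  have hi2 : 1 ≤ i ^ 2 := one_le_pow₀ hi1
  have hl0 : 0 < l := by linarith
  have hli : l ≤ l * i ^ 2 := le_mul_of_one_le_right hl0.le hi2
  push_cast
  have h3 : (Nat.log 2 m : ℝ) +
      ((⌊Real.log (2 * m) / Real.log (1 + (ε / 2) ^ 2)⌋₊ : ℝ) + 1 + 1) + 2 ≤ 24 * (l * i ^ 2) := by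
    nlinarith
  have h4 : 14 + 12 * l ≤ 33 * l := by linarith
  have h5 : l ≤ 1.5 * l ^ 2 := by nlinarith
  have h6 : l ^ 2 ≤ 2.25 * l ^ 4 := by nlinarith [sq_nonneg (l ^ 2)]
  have h7 : l ^ 2 ≤ l ^ 2 * i ^ 2 := le_mul_of_one_le_right (by positivity) hi2
  calc _ ≤ 3 + 24 * (l * i ^ 2) * (33 * l) := by gcongr
    _ ≤ 4.5 * l + 792 * (l ^ 2 * i ^ 2) := by nlinarith
    _ ≤ 800 * (l ^ 2 * i ^ 2) := by nlinarith
    _ ≤ 800 * (2.25 * l ^ 4 * i ^ 3) := by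
        rw [mul_comm (l ^ 2), mul_comm _ (i ^ 3)]
        have : i ^ 2 ≤ i ^ 3 := pow_le_pow_right₀ hi1 (by norm_num)
        gcongr
    _ ≤ _ := by
        have : 0 ≤ l ^ 4 * i ^ 3 := by positivity
        nlinarith

end Main

end BundlePricing

theorem mainTheorem3 :
    ∃ C : ℝ, 0 < C ∧
      ∀ (m : ℕ), 2 ≤ m →
      ∀ (D : MeasureTheory.Measure (BundlePricing.SetFun m)),
        MeasureTheory.IsProbabilityMeasure D →
        (∀ᵐ v ∂D, BundlePricing.IsWeightedMatroidRank v) →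
      ∀ (M₁ : BundlePricing.BundleSizeMenu m) (ε : ℝ), 0 < ε →
      ∃ M₂ : BundlePricing.BundleSizeMenu m,
        (∀ (β₁ : BundlePricing.BuyerRule M₁) (β₂ : BundlePricing.BuyerRule M₂),
          (1 - ε) * β₁.revenue D ≤ β₂.revenue D) ∧
        ∃ A : BundlePricing.QueryAlg m,
          (∀ v : BundlePricing.SetFun m, BundlePricing.IsWeightedMatroidRank v →
            A.AlwaysReturns v (M₂.IsMostProfitable v)) ∧
          BundlePricing.upperExpectation D (fun v => A.expectedQueries v) ≤
            ENNReal.ofReal (C * (ε⁻¹) ^ 3 * (Real.log m) ^ 4) := by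
  refine ⟨2000, by norm_num, fun m hm D hD hv M₁ ε hε => ?_⟩
  -- For `ε ≥ 1` the revenue requirement is void, and selling nothing takes no queries.
  rcases le_or_gt 1 ε with hε1 | hε1
  · refine ⟨BundlePricing.BundleSizeMenu.trivial m, fun β₁ β₂ => ?_, .output ∅, fun v _ => ?_, ?_⟩
    · exact (mul_nonpos_of_nonpos_of_nonneg (by linarith) (β₁.revenue_nonneg D)).trans
        (β₂.revenue_nonneg D)
    · refine ⟨by simp [BundlePricing.BundleSizeMenu.trivial], fun T hT => ?_⟩
      have : T = ∅ := by simpa [BundlePricing.BundleSizeMenu.trivial] using hT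
      rw [this]
    · refine (BundlePricing.upperExpectation_le D MeasurableSet.empty (a := 0) (w := 0)
        (Filter.Eventually.of_forall fun v _ => le_rfl) fun v => le_rfl).trans ?_
      simp
  have hβ : ε / 2 < 1 := by linarith
  have hpos : 0 < (ε / 2) ^ 2 := by positivity
  have hh : 0 < Real.log (1 + (ε / 2) ^ 2) := Real.log_pos (by linarith)
  set h := Real.log (1 + (ε / 2) ^ 2) with hh'
  set M₂ := M₁.rounded hh hβ with hM₂
  have hN := M₂.card_window_le (M₁.card_rounded_filter_le (by omega) hh hβ)
  set N := ⌊Real.log (2 * m) / h⌋₊ + 1 + 1 with hN'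
  -- The cost bound valid on every valuation, brute force included. It does not involve `η`, so `η`
  -- may be chosen afterwards with failure probability at most `W⁻¹`.
  set W : ℝ≥0∞ := 2 + (Nat.log 2 m + N + 2 : ℕ) * ((3 * m : ℕ) + (2 + (2 ^ m : ℕ))) with hW
  have hWtop : W ≠ ⊤ := by
    have : W = ((2 + (Nat.log 2 m + N + 2) * (3 * m + (2 + 2 ^ m)) : ℕ) : ℝ≥0∞) := by
      rw [hW]; push_cast; ring
    rw [this]
    exact ENNReal.natCast_ne_top _
  obtain ⟨η, hη, hD'⟩ := BundlePricing.exists_measure_not_hasGap_le D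
    (ENNReal.inv_pos.2 hWtop)
  refine ⟨M₂, fun β₁ β₂ => β₁.revenue_le β₂ D ?_, BundlePricing.findBundle M₂ η,
    fun v hv => BundlePricing.findBundle_alwaysReturns hv η, ?_⟩
  · filter_upwards [hv] with v hv S T hS hT
    have := M₁.le_price_rounded hv hh (by positivity) hβ (Real.exp_log (by positivity)).le hS hT
    rwa [mul_div_cancel₀ _ (two_ne_zero' ℝ)] at this
  · refine (BundlePricing.upperExpectation_le D
      (B := {v | ¬ BundlePricing.HasGap η v}) (w := W)
      (a := 2 + (Nat.log 2 m + N + 2 : ℕ) * ENNReal.ofReal (14 + 12 * Real.log m))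
      (BundlePricing.measurableSet_hasGap η).compl ?_ fun v =>
        BundlePricing.findBundle_expectedQueries_le_of_fallback v η hN).trans ?_
    · filter_upwards [hv] with v hv hgap
      exact BundlePricing.findBundle_expectedQueries_le_of_hasGap hv hη (not_not.1 hgap) hN
    · have h1 : W * D {v | ¬ BundlePricing.HasGap η v} ≤ 1 :=
        (mul_le_mul_right hD' W).trans (ENNReal.mul_inv_le_one W)
      refine (add_le_add_right h1 _).trans ?_
      have hlog : 0 ≤ Real.log m := Real.log_natCast_nonneg _
      have h2 : (2 : ℝ≥0∞) + (Nat.log 2 m + N + 2 : ℕ) * ENNReal.ofReal (14 + 12 * Real.log m) + 1 =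
          ENNReal.ofReal (3 + ((Nat.log 2 m : ℝ) + N + 2) * (14 + 12 * Real.log m)) := by
        rw [show ((Nat.log 2 m : ℝ) + N + 2) = ((Nat.log 2 m + N + 2 : ℕ) : ℝ) by push_cast; ring]
        generalize Nat.log 2 m + N + 2 = K
        rw [ENNReal.ofReal_add (p := 3) (by norm_num) (by positivity),
          ENNReal.ofReal_mul (p := (K : ℝ)) (by positivity),
          ENNReal.ofReal_natCast, add_right_comm]
        norm_num
      rw [h2]
      exact ENNReal.ofReal_le_ofReal (BundlePricing.query_bound hm hε hε1)
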